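/- Let $G=(V,E,w)$ be a simple graph with vertex set $V=\{1,\dots,n\}$ and positive edge weights $w:E\to\mathbb{R}_{>0}$. For $1\le k<n$, the $k$-th token graph $F_k(G)$ is the weighted simple graph whose vertices are the $k$-element subsets of $V$, where $A$ and $B$ are adjacent if and only if $A\triangle B=\{a,b\}$ with $a\in A$, $b\in B$ and $ab\in E$; the weight of this edge is $w_{ab}$. For a weighted graph $H$ let $A(H)$ be its weighted adjacency matrix, $D(H)$ its diagonal matrix of weighted degrees, $L(H)=D(H)-A(H)$ and $Q(H)=D(H)+A(H)$, and let $\lambda_{\max}$ and $\lambda_{\min}$ denote the largest and smallest eigenvalues of a real symmetric matrix. Let $W(G)=\sum_{e\in E}w_e$, and let $M_k(G)$ be the maximum weight of a matching of $G$ with at most $k$ edges. An unweighted graph is regarded as a weighted graph all of whose edge weights are $1$. Consider the following four statements, each asserted for all $n$, all unweighted graphs $G$ with $n$ vertices and $m$ edges, and all $1\le k\le\lfloor n/2\rfloor$: 1. $\lambda_{\max}(L(F_k(G)))\le m+k$; 2. $\lambda_{\max}(Q(F_k(G)))\le m+k$; 3. $\lambda_{\max}(A(F_k(G)))\le \tfrac12(m+k)$;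 4. $\lambda_{\min}(A(F_k(G)))\ge -\tfrac12(m+k)$. **Lemma.** For every weighted graph $G$ with $n$ vertices and positive edge weights, and every $1\le k\le\lfloor n/2\rfloor$: * if statement 1 holds, then $\lambda_{\max}(L(F_k(G)))\le W(G)+M_k(G)$; * if statement 2 holds, then $\lambda_{\max}(Q(F_k(G)))\le W(G)+M_k(G)$; * if statement 3 holds, then $\lambda_{\max}(A(F_k(G)))\le \tfrac12\,(W(G)+M_k(G))$; * if statement 4 holds, then $\lambda_{\min}(A(F_k(G)))\ge -\tfrac12\,(W(G)+M_k(G))$. -/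

import Mathlib

open scoped symmDiff

noncomputable section

/-- A simple graph on `V` with positive edge weights. The function `weight` is only ever used at
edges of `graph`; its values elsewhere are irrelevant. -/
structure WeightedGraph (V : Type*) where
  graph : SimpleGraph V
  weight : Sym2 V → ℝ
  weight_pos : ∀ e ∈ graph.edgeSet, 0 < weight e

namespace WeightedGraph

/-- An unweighted graph, seen as the weighted graph all of whose edges have weight `1`. -/
def unweighted {V : Type*} (G : SimpleGraph V) : WeightedGraph V where
  graph := G
  weight := fun _ => 1
  weight_pos := fun _ _ => one_pos

section Matrices

open Classical in
/-- The weighted adjacency matrix `A(G)`. -/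
def adjacency {V : Type*} (G : WeightedGraph V) : Matrix V V ℝ :=
  Matrix.of fun u v => if G.graph.Adj u v then G.weight s(u, v) else 0

theorem adjacency_isHermitian {V : Type*} (G : WeightedGraph V) : G.adjacency.IsHermitian := by
  ext u v
  by_cases h : G.graph.Adj u v
  · simp [adjacency, h, h.symm, Sym2.eq_swap (a := v) (b := u)]
  · have h' : ¬ G.graph.Adj v u := fun h' => h h'.symm
    simp [adjacency, h, h']

variable {V : Type*} [Fintype V] [DecidableEq V]

/-- The weighted degree matrix `D(G)`. -/
def degreeMatrix (G : WeightedGraph V) : Matrix V V ℝ :=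
  Matrix.diagonal fun u => ∑ v, G.adjacency u v

/-- The Laplacian `L(G) = D(G) - A(G)`. -/
def laplacian (G : WeightedGraph V) : Matrix V V ℝ := G.degreeMatrix - G.adjacency

/-- The signless Laplacian `Q(G) = D(G) + A(G)`. -/
def signlessLaplacian (G : WeightedGraph V) : Matrix V V ℝ := G.degreeMatrix + G.adjacency

theorem degreeMatrix_isHermitian (G : WeightedGraph V) : G.degreeMatrix.IsHermitian := by
  simp [degreeMatrix, Matrix.IsHermitian]

theorem laplacian_isHermitian (G : WeightedGraph V) : G.laplacian.IsHermitian :=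
  G.degreeMatrix_isHermitian.sub G.adjacency_isHermitian

theorem signlessLaplacian_isHermitian (G : WeightedGraph V) : G.signlessLaplacian.IsHermitian :=
  G.degreeMatrix_isHermitian.add G.adjacency_isHermitian

end Matrices

section Weights

variable {V : Type*} [Fintype V]

open Classical in
/-- The total weight `W(G)`, the sum of all edge weights. -/
def totalWeight (G : WeightedGraph V) : ℝ := ∑ e ∈ G.graph.edgeFinset, G.weight e

open Classical in
/-- The matchings of `G` with at most `k` edges: sets `R` of at most `k` edges such that every
vertex is incident to at most one edge of `R`. -/
def matchings (G : WeightedGraph V) (k : ℕ) : Finset (Finset (Sym2 V)) :=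
  {R ∈ G.graph.edgeFinset.powerset |
    (∀ v : V, (R.filter fun e => v ∈ e).card ≤ 1) ∧ R.card ≤ k}

theorem matchings_nonempty (G : WeightedGraph V) (k : ℕ) : (G.matchings k).Nonempty :=
  ⟨∅, by simp [matchings]⟩

/-- `M_k(G)`, the maximum weight of a matching of `G` with at most `k` edges. -/
def maxMatchingWeight (G : WeightedGraph V) (k : ℕ) : ℝ :=
  (G.matchings k).sup' (G.matchings_nonempty k) fun R => ∑ e ∈ R, G.weight e

end Weights

section Token

variable {V : Type*} [DecidableEq V]

/-- The sum of the weights `w_{ab}` over `a ∈ A \ B` and `b ∈ B \ A`. If `A ∆ B = {a, b}` with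
`a ∈ A` and `b ∈ B` there is exactly one term, namely `w_{ab}`: see `tokenWeight_eq`. -/
def tokenWeight (G : WeightedGraph V) (k : ℕ) : Sym2 {A : Finset V // A.card = k} → ℝ :=
  Sym2.lift ⟨fun A B => ∑ a ∈ A.1 \ B.1, ∑ b ∈ B.1 \ A.1, G.weight s(a, b), fun A B => by
    refine Finset.sum_comm.trans ?_
    exact Finset.sum_congr rfl fun b _ => Finset.sum_congr rfl fun a _ => by rw [Sym2.eq_swap]⟩

theorem tokenWeight_eq (G : WeightedGraph V) (k : ℕ) (A B : {A : Finset V // A.card = k})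
    (a b : V) (ha : a ∈ A.1) (hb : b ∈ B.1) (h : A.1 ∆ B.1 = {a, b}) :
    G.tokenWeight k s(A, B) = G.weight s(a, b) := by
  have key : ∀ x, (x ∈ A.1 ∧ x ∉ B.1 ∨ x ∈ B.1 ∧ x ∉ A.1) ↔ (x = a ∨ x = b) := by
    intro x
    rw [← Finset.mem_symmDiff, h]
    simp
  have h1 : A.1 \ B.1 = {a} := by
    ext x
    have := key x; have := key a; have := key b
    simp only [Finset.mem_sdiff, Finset.mem_singleton]
    grind
  have h2 : B.1 \ A.1 = {b} := by
    ext x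
    have := key x; have := key a; have := key b
    simp only [Finset.mem_sdiff, Finset.mem_singleton]
    grind
  simp [tokenWeight, h1, h2]

/-- The `k`-th token graph `F_k(G)`: its vertices are the `k`-element sets of vertices of `G`, two of
them being adjacent iff their symmetric difference is a pair `{a, b}` with `a ∈ A`, `b ∈ B` and
`ab` an edge of `G`; the weight of such an edge is `w_{ab}`. -/
def token (G : WeightedGraph V) (k : ℕ) : WeightedGraph {A : Finset V // A.card = k} where
  graph :=
    { Adj := fun A B => ∃ a ∈ A.1, ∃ b ∈ B.1, A.1 ∆ B.1 = {a, b} ∧ G.graph.Adj a b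
      symm := ⟨fun A B => by
        rintro ⟨a, ha, b, hb, h, hab⟩
        exact ⟨b, hb, a, ha, by rw [symmDiff_comm, h, Finset.pair_comm], hab.symm⟩⟩
      loopless := ⟨fun A => by
        rintro ⟨a, ha, b, hb, h, hab⟩
        have : a ∈ A.1 ∆ A.1 := by rw [h]; simp
        simp at this⟩ }
  weight := G.tokenWeight k
  weight_pos := fun e => by
    induction e using Sym2.ind with
    | _ A B =>
      rintro ⟨a, ha, b, hb, h, hab⟩
      rw [G.tokenWeight_eq k A B a b ha hb h]
      exact G.weight_pos _ hab

end Token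

end WeightedGraph

section Eigenvalues

variable {ι : Type*} [Fintype ι] [DecidableEq ι]

/-- The set of real eigenvalues of a real square matrix. -/
def eigs (M : Matrix ι ι ℝ) : Set ℝ := {μ | Module.End.HasEigenvalue (Matrix.toLin' M) μ}

/-- The maximum eigenvalue of a real symmetric matrix. -/
def lambdaMax (M : Matrix ι ι ℝ) : ℝ := sSup (eigs M)

/-- The minimum eigenvalue of a real symmetric matrix. -/
def lambdaMin (M : Matrix ι ι ℝ) : ℝ := sInf (eigs M)

theorem eigs_finite (M : Matrix ι ι ℝ) : (eigs M).Finite :=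
  Module.End.finite_hasEigenvalue (Matrix.toLin' M)

theorem eigs_nonempty [Nonempty ι] {M : Matrix ι ι ℝ} (hM : M.IsHermitian) :
    (eigs M).Nonempty := by
  obtain ⟨i⟩ := ‹Nonempty ι›
  refine ⟨hM.eigenvalues i, ?_⟩
  have h := hM.eigenvalues_mem_spectrum_real i
  rw [← Matrix.spectrum_toLin'] at h
  exact Module.End.hasEigenvalue_iff_mem_spectrum.mpr h

theorem isGreatest_lambdaMax [Nonempty ι] {M : Matrix ι ι ℝ} (hM : M.IsHermitian) :
    IsGreatest (eigs M) (lambdaMax M) :=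
  ⟨(eigs_nonempty hM).csSup_mem (eigs_finite M), fun _ h => le_csSup (eigs_finite M).bddAbove h⟩

theorem isLeast_lambdaMin [Nonempty ι] {M : Matrix ι ι ℝ} (hM : M.IsHermitian) :
    IsLeast (eigs M) (lambdaMin M) :=
  ⟨(eigs_nonempty hM).csInf_mem (eigs_finite M), fun _ h => csInf_le (eigs_finite M).bddBelow h⟩

end Eigenvalues

/- The four conjectures on unweighted graphs `G` with `n` vertices and `m` edges; in each of them
`k` ranges over `1 ≤ k ≤ ⌊n / 2⌋`. -/

open Classical in
/-- `λ_max(L(F_k(G))) ≤ m + k` for all unweighted graphs. -/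
def ConjectureLMax : Prop :=
  ∀ (n : ℕ) (G : SimpleGraph (Fin n)) (k : ℕ), 1 ≤ k → k ≤ n / 2 →
    lambdaMax ((WeightedGraph.unweighted G).token k).laplacian ≤ (G.edgeFinset.card : ℝ) + k

open Classical in
/-- `λ_max(Q(F_k(G))) ≤ m + k` for all unweighted graphs. -/
def ConjectureQMax : Prop :=
  ∀ (n : ℕ) (G : SimpleGraph (Fin n)) (k : ℕ), 1 ≤ k → k ≤ n / 2 →
    lambdaMax ((WeightedGraph.unweighted G).token k).signlessLaplacian
      ≤ (G.edgeFinset.card : ℝ) + k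

open Classical in
/-- `λ_max(A(F_k(G))) ≤ (m + k) / 2` for all unweighted graphs. -/
def ConjectureAMax : Prop :=
  ∀ (n : ℕ) (G : SimpleGraph (Fin n)) (k : ℕ), 1 ≤ k → k ≤ n / 2 →
    lambdaMax ((WeightedGraph.unweighted G).token k).adjacency
      ≤ 1 / 2 * ((G.edgeFinset.card : ℝ) + k)

open Classical in
/-- `λ_min(A(F_k(G))) ≥ -(m + k) / 2` for all unweighted graphs. -/
def ConjectureAMin : Prop :=
  ∀ (n : ℕ) (G : SimpleGraph (Fin n)) (k : ℕ), 1 ≤ k → k ≤ n / 2 →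
    lambdaMin ((WeightedGraph.unweighted G).token k).adjacency
      ≥ -(1 / 2) * ((G.edgeFinset.card : ℝ) + k)

end

/-! Each of the four matrices, the adjacency matrix being scaled by `2` or `-2`, has the form `α D +
β A`. Extend a nonzero vector on the `k`-sets by zero to a function `f` on all vertex sets. Its
quadratic form is then `∑ w_e q_e` over the edges `e = ab`, where `q_e = pairForm a b + pairForm b
a` does not involve the weights. With `N = ∑ f²` and `y_e = q_e / N - 1`, the desired bound reads `∑
w_e y_e ≤ M_k`. This is a statement about the polytope of matchings with at most `k` edges, and by
Edmonds' theorem three families of inequalities suffice.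

Stars: `∑ y_e ≤ 1` over edges at one vertex. This is the bound `d + 1` for a star with `d` edges,
which holds unconditionally by a weighted Cauchy-Schwarz inequality (`sum_star_pairForm_le`). Vertex
sets: `∑ y_e ≤ ⌊|S|/2⌋` over edges inside `S`. The tokens outside `S` are frozen and the unweighted
conjecture is applied to graphs on `S`, after complementation if more than half of `S` is occupied.
Cardinality: `∑ y_e ≤ k` over any edges. This is the conjecture at level `k`. Each inequality is
available for every subset of the edges concerned, so negative entries of `y` need no separate
treatment.

Edmonds' theorem is proved for integral weights by induction on their sum: the weights on a star, on
a component or on the whole graph are lowered by `1`, and exchange arguments show that the optimal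
matching weight drops by at least the right-hand side of the corresponding inequality. Real weights
follow by scaling and rounding down. Matchings are encoded as involutions and sums run over ordered
pairs, so every matching weight appears doubled. -/

/-! ### Cycles of a product of two involutions (alternating paths of two matchings). -/

section InvolutionPairs

variable {V : Type*} {σ τ : Equiv.Perm V}

theorem Equiv.Perm.zpow_apply_eq_zpow_apply_iff (ρ : Equiv.Perm V) (t : V) (i j : ℤ) :
    (ρ ^ i) t = (ρ ^ j) t ↔ (MulAction.period ρ t : ℤ) ∣ i - j := by
  rw [← MulAction.zpow_smul_eq_iff_period_dvd, Equiv.Perm.smul_def, sub_eq_neg_add, zpow_add,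
    zpow_neg, Equiv.Perm.mul_apply, Equiv.Perm.inv_eq_iff_eq, eq_comm, eq_comm]

/-- Conjugation by `τ` inverts `σ * τ`. On the cycle through a fixed point `t` of `τ`, the
involutions `τ` and `σ` therefore act on exponents as the reflections `i ↦ -i` and `i ↦ 1 - i`, so
being a fixed point becomes divisibility of `2 i` or `2 i - 1` by the period. Such a cycle is the
alternating path that starts at `t`. -/
theorem zpow_mul_involutions_apply_right (hσ : ∀ v, σ (σ v) = v) (hτ : ∀ v, τ (τ v) = v) {t : V}
    (ht : τ t = t) (i : ℤ) : τ (((σ * τ) ^ i) t) = ((σ * τ) ^ (-i)) t := by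
  have h1 : σ * σ = 1 := Equiv.ext hσ
  have h2 : τ * τ = 1 := Equiv.ext hτ
  have h3 : τ * (σ * τ) * τ⁻¹ = (σ * τ)⁻¹ := by
    rw [mul_inv_rev, inv_eq_of_mul_eq_one_right h1, inv_eq_of_mul_eq_one_right h2,
      mul_assoc, mul_assoc, h2, mul_one]
  have h5 : τ * (σ * τ) ^ i = (σ * τ) ^ (-i) * τ := by
    rw [← mul_inv_eq_iff_eq_mul, ← conj_zpow, h3, inv_zpow, zpow_neg]
  have := congrArg (fun π : Equiv.Perm V => π t) h5
  simpa only [Equiv.Perm.mul_apply, ht] using this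

theorem zpow_mul_involutions_apply_left (hσ : ∀ v, σ (σ v) = v) (hτ : ∀ v, τ (τ v) = v) {t : V}
    (ht : τ t = t) (i : ℤ) : σ (((σ * τ) ^ i) t) = ((σ * τ) ^ (1 - i)) t := by
  have h := zpow_mul_involutions_apply_right hσ hτ ht i
  rw [sub_eq_add_neg, zpow_add, zpow_one, Equiv.Perm.mul_apply, ← h, Equiv.Perm.mul_apply, hτ]

theorem sameCycle_mul_involutions_right (hσ : ∀ v, σ (σ v) = v) (hτ : ∀ v, τ (τ v) = v)
    {t v : V} (ht : τ t = t) (h : (σ * τ).SameCycle t v) : (σ * τ).SameCycle t (τ v) := by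
  obtain ⟨i, rfl⟩ := h
  exact ⟨-i, (zpow_mul_involutions_apply_right hσ hτ ht i).symm⟩

theorem sameCycle_mul_involutions_left (hσ : ∀ v, σ (σ v) = v) (hτ : ∀ v, τ (τ v) = v)
    {t v : V} (ht : τ t = t) (h : (σ * τ).SameCycle t v) : (σ * τ).SameCycle t (σ v) := by
  obtain ⟨i, rfl⟩ := h
  exact ⟨1 - i, (zpow_mul_involutions_apply_left hσ hτ ht i).symm⟩

/-- If two involutions both fix points of a common cycle of their product, then the fixed point of
the second involution on that cycle is unique. -/
theorem eq_of_fixed_right_of_fixed_left (hσ : ∀ v, σ (σ v) = v) (hτ : ∀ v, τ (τ v) = v)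
    {t p u : V} (ht : τ t = t) (hp : σ p = p) (hu : τ u = u)
    (htp : (σ * τ).SameCycle t p) (htu : (σ * τ).SameCycle t u) : u = t := by
  obtain ⟨i, rfl⟩ := htp
  obtain ⟨j, rfl⟩ := htu
  rw [zpow_mul_involutions_apply_left hσ hτ ht, Equiv.Perm.zpow_apply_eq_zpow_apply_iff] at hp
  rw [zpow_mul_involutions_apply_right hσ hτ ht, Equiv.Perm.zpow_apply_eq_zpow_apply_iff] at hu
  have h := (σ * τ).zpow_apply_eq_zpow_apply_iff t j 0
  rw [zpow_zero, Equiv.Perm.one_apply] at h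
  rw [h]
  have e : j - 0 = j * (1 - i - i) - i * (-j - j) := by ring
  rw [e]
  exact (hp.mul_left j).sub (hu.mul_left i)

/-- A cycle of the product of two involutions through a fixed point of the second one contains at
most one fixed point of the first one. -/
theorem eq_of_fixed_left (hσ : ∀ v, σ (σ v) = v) (hτ : ∀ v, τ (τ v) = v)
    {t p q : V} (ht : τ t = t) (hp : σ p = p) (hq : σ q = q)
    (htp : (σ * τ).SameCycle t p) (htq : (σ * τ).SameCycle t q) : p = q := by
  obtain ⟨i, rfl⟩ := htp
  obtain ⟨j, rfl⟩ := htq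
  rw [zpow_mul_involutions_apply_left hσ hτ ht, Equiv.Perm.zpow_apply_eq_zpow_apply_iff] at hp hq
  rw [Equiv.Perm.zpow_apply_eq_zpow_apply_iff]
  have e : i - j = i * (1 - j - j - (1 - i - i)) + (i - j) * (1 - i - i) := by ring
  rw [e]
  exact ((hq.sub hp).mul_left i).add (hp.mul_left (i - j))

/-- A cycle of the product of two involutions contains at most two fixed points of the second
one. -/
theorem eq_of_fixed_right (hσ : ∀ v, σ (σ v) = v) (hτ : ∀ v, τ (τ v) = v)
    {t p q : V} (ht : τ t = t) (hp : τ p = p) (hq : τ q = q)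
    (htp : (σ * τ).SameCycle t p) (htq : (σ * τ).SameCycle t q) (hpt : p ≠ t) (hqt : q ≠ t) :
    p = q := by
  obtain ⟨i, rfl⟩ := htp
  obtain ⟨j, rfl⟩ := htq
  have h := fun i => (σ * τ).zpow_apply_eq_zpow_apply_iff t i 0
  simp only [zpow_zero, Equiv.Perm.one_apply, sub_zero] at h
  rw [Ne, h] at hpt hqt
  rw [zpow_mul_involutions_apply_right hσ hτ ht, Equiv.Perm.zpow_apply_eq_zpow_apply_iff] at hp hq
  rw [Equiv.Perm.zpow_apply_eq_zpow_apply_iff]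
  obtain ⟨a, ha⟩ := hp
  obtain ⟨b, hb⟩ := hq
  -- The period divides `2 i` but not `i`, so the quotient is odd. Two odd quotients differ by an
  -- even number, hence the period divides `i - j`.
  have key : ∀ i a : ℤ, -i - i = (MulAction.period (σ * τ) t : ℤ) * a →
      ¬ (MulAction.period (σ * τ) t : ℤ) ∣ i → Odd a := by
    intro i a ha hi
    by_contra hodd
    obtain ⟨c, rfl⟩ := Int.not_odd_iff_even.mp hodd
    exact hi ⟨-c, by linarith⟩
  obtain ⟨c, rfl⟩ := key i a ha hpt
  obtain ⟨d, rfl⟩ := key j b hb hqt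
  exact ⟨d - c, by linarith⟩

end InvolutionPairs

/-! ### Exchanging two involutions on a common invariant set. -/

section Mix

variable {V : Type*}

/-- The involution that agrees with `τ` on the invariant set `C` and with `σ` off `C`. -/
def mixInvolutions [DecidableEq V] (σ τ : Equiv.Perm V) (C : Finset V) (hσ : ∀ v, σ (σ v) = v)
    (hτ : ∀ v, τ (τ v) = v) (hσC : ∀ v ∈ C, σ v ∈ C) (hτC : ∀ v ∈ C, τ v ∈ C) :
    Equiv.Perm V :=
  Function.Involutive.toPerm (fun v => if v ∈ C then τ v else σ v) fun v => by
    by_cases h : v ∈ C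
    · simp [h, hτC v h, hτ]
    · have : σ v ∉ C := fun h' => h (by simpa [hσ] using hσC _ h')
      simp [h, this, hσ]

theorem mixInvolutions_apply [DecidableEq V] {σ τ : Equiv.Perm V} {C : Finset V} (hσ : ∀ v, σ (σ v) = v)
    (hτ : ∀ v, τ (τ v) = v) (hσC : ∀ v ∈ C, σ v ∈ C) (hτC : ∀ v ∈ C, τ v ∈ C) (v : V) :
    mixInvolutions σ τ C hσ hτ hσC hτC v = if v ∈ C then τ v else σ v := rfl

/-- The two points of a nontrivial orbit contribute equal terms, and fixed points contribute `0`. -/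
theorem even_sum_involution {σ : Equiv.Perm V} (hσ : ∀ v, σ (σ v) = v) (S : Finset V)
    (hS : ∀ v ∈ S, σ v ∈ S) (w : V → V → ℕ) (hw : ∀ a b, w a b = w b a) (hw0 : ∀ a, w a a = 0) :
    Even (∑ v ∈ S, w v (σ v)) := by
  rw [← ZMod.natCast_eq_zero_iff_even, Nat.cast_sum]
  refine Finset.sum_involution (fun v _ => σ v) ?_ ?_ hS ?_
  · intro v _
    rw [hσ, hw (σ v) v]
    exact CharTwo.add_self_eq_zero _
  · intro v _ h h'
    rw [h', hw0] at h
    simp at h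
  · intro v _
    exact hσ v

theorem even_card_filter_apply_ne [DecidableEq V] {σ : Equiv.Perm V} (hσ : ∀ v, σ (σ v) = v)
    (S : Finset V) (hS : ∀ v ∈ S, σ v ∈ S) : Even (S.filter fun v => σ v ≠ v).card := by
  have := even_sum_involution hσ S hS (fun a b => if b ≠ a then 1 else 0)
    (fun a b => by simp only [ne_comm]) (fun a => by simp)
  rwa [Finset.card_filter]

/-- If the involution `τ` fixes more points than `σ`, then some set invariant under both contains
exactly two more fixed points of `τ` than of `σ`. -/
theorem exists_invariant_two_more_fixed [Fintype V] [DecidableEq V] {σ τ : Equiv.Perm V} (hσ : ∀ v, σ (σ v) = v)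
    (hτ : ∀ v, τ (τ v) = v)
    (h : (Finset.univ.filter fun v => τ v ≠ v).card < (Finset.univ.filter fun v => σ v ≠ v).card) :
    ∃ C : Finset V, (∀ v ∈ C, σ v ∈ C) ∧ (∀ v ∈ C, τ v ∈ C) ∧
      (C.filter fun v => σ v ≠ v).card = (C.filter fun v => τ v ≠ v).card + 2 := by
  classical
  have hcount : (Finset.univ.filter fun v => σ v = v).card <
      (Finset.univ.filter fun v => τ v = v).card := by
    have h1 := Finset.card_filter_add_card_filter_not (s := (Finset.univ : Finset V))
      (fun v => σ v = v)
    have h2 := Finset.card_filter_add_card_filter_not (s := (Finset.univ : Finset V))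
      (fun v => τ v = v)
    simp only [ne_eq] at h
    omega
  -- Otherwise choosing a fixed point of `σ` on the cycle of each fixed point of `τ` would be an
  -- injection, because such a cycle contains only one fixed point of `τ`.
  obtain ⟨t, ht, hno⟩ : ∃ t, τ t = t ∧ ∀ p, (σ * τ).SameCycle t p → σ p ≠ p := by
    by_contra! hcon
    choose! f hf1 hf2 using hcon
    refine absurd (Finset.card_le_card_of_injOn f ?_ ?_) (not_le.mpr hcount)
    · intro t ht
      have ht' : τ t = t := by simpa using ht
      simpa using hf2 t ht'
    · intro t ht t' ht' hff
      have h1 : τ t = t := by simpa using ht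
      have h2 : τ t' = t' := by simpa using ht'
      have hc : (σ * τ).SameCycle t t' := (hf1 t h1).trans (hff ▸ (hf1 t' h2).symm)
      exact (eq_of_fixed_right_of_fixed_left hσ hτ h1 (hf2 t h1) h2 (hf1 t h1) hc).symm
  refine ⟨Finset.univ.filter fun v => (σ * τ).SameCycle t v, ?_, ?_, ?_⟩
  · intro v hv
    have hv' : (σ * τ).SameCycle t v := by simpa using hv
    simpa using sameCycle_mul_involutions_left hσ hτ ht hv'
  · intro v hv
    have hv' : (σ * τ).SameCycle t v := by simpa using hv
    simpa using sameCycle_mul_involutions_right hσ hτ ht hv'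
  · set C := Finset.univ.filter fun v => (σ * τ).SameCycle t v with hC
    have hmem : ∀ v, v ∈ C ↔ (σ * τ).SameCycle t v := by simp [hC]
    have hσC : ∀ v ∈ C, σ v ∈ C := fun v hv => by
      rw [hmem] at hv ⊢
      exact sameCycle_mul_involutions_left hσ hτ ht hv
    have hτC : ∀ v ∈ C, τ v ∈ C := fun v hv => by
      rw [hmem] at hv ⊢
      exact sameCycle_mul_involutions_right hσ hτ ht hv
    -- `σ` moves every point of `C`, so `|C|` is even, and then so is the number of fixed points of
    -- `τ` in `C`. That number is at least one because of `t` and at most two, hence exactly two.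
    have e1 := even_card_filter_apply_ne hσ C hσC
    have e2 := even_card_filter_apply_ne hτ C hτC
    have s1 : (C.filter fun v => σ v ≠ v) = C :=
      Finset.filter_true_of_mem fun v hv => hno v ((hmem v).mp hv)
    have s2 := Finset.card_filter_add_card_filter_not (s := C) (fun v => τ v = v)
    have s3 : 0 < (C.filter fun v => τ v = v).card :=
      Finset.card_pos.mpr ⟨t, by simp [hmem, ht, Equiv.Perm.SameCycle.refl]⟩
    have s4 : ((C.filter fun v => τ v = v).erase t).card ≤ 1 := by
      rw [Finset.card_le_one]
      intro p hp q hq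
      simp only [Finset.mem_erase, Finset.mem_filter, hmem] at hp hq
      exact eq_of_fixed_right hσ hτ ht hp.2.2 hq.2.2 hp.2.1 hq.2.1 hp.1 hq.1
    rw [Finset.card_erase_of_mem (by simp [hmem, ht, Equiv.Perm.SameCycle.refl])] at s4
    rw [s1] at e1 ⊢
    simp only [ne_eq] at e2 ⊢
    obtain ⟨a, ha⟩ := e1
    obtain ⟨b, hb⟩ := e2
    omega

/-- If the involution `τ` fixes `t`, then some set invariant under `σ` and `τ` contains `t` and at
most one fixed point of the involution `σ`. -/
theorem exists_invariant_at_most_one_fixed [Fintype V] [DecidableEq V] {σ τ : Equiv.Perm V}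
    (hσ : ∀ v, σ (σ v) = v) (hτ : ∀ v, τ (τ v) = v) {t : V} (ht : τ t = t) :
    ∃ C : Finset V, (∀ v ∈ C, σ v ∈ C) ∧ (∀ v ∈ C, τ v ∈ C) ∧ t ∈ C ∧
      ∀ u ∈ C, ∀ v ∈ C, σ u = u → σ v = v → u = v := by
  classical
  refine ⟨Finset.univ.filter fun v => (σ * τ).SameCycle t v, ?_, ?_, ?_, ?_⟩
  · intro v hv
    have hv' : (σ * τ).SameCycle t v := by simpa using hv
    simpa using sameCycle_mul_involutions_left hσ hτ ht hv'
  · intro v hv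
    have hv' : (σ * τ).SameCycle t v := by simpa using hv
    simpa using sameCycle_mul_involutions_right hσ hτ ht hv'
  · simpa using Equiv.Perm.SameCycle.refl _ t
  · intro u hu v hv hfu hfv
    exact eq_of_fixed_left hσ hτ ht hfu hfv (by simpa using hu) (by simpa using hv)

end Mix

/-! ### Weighted matchings as involutions, and exchange arguments for a lexicographic objective. -/

section WeightedMatching

variable {V : Type*}

/-- `σ` is an involution whose non-trivial orbits are pairs of positive weight: it encodes the
matching formed by these pairs. -/
structure IsMatchingInvolution (w : V → V → ℕ) (σ : Equiv.Perm V) : Prop where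
  apply_apply : ∀ v, σ (σ v) = v
  weight_pos : ∀ v, σ v ≠ v → 0 < w v (σ v)

theorem isMatchingInvolution_one (w : V → V → ℕ) : IsMatchingInvolution w 1 :=
  ⟨fun _ => rfl, fun _ h => absurd rfl h⟩

theorem IsMatchingInvolution.mono {w w' : V → V → ℕ} (h : ∀ a b, w' a b ≤ w a b)
    {σ : Equiv.Perm V} (hσ : IsMatchingInvolution w' σ) : IsMatchingInvolution w σ :=
  ⟨hσ.1, fun v hv => (hσ.2 v hv).trans_le (h _ _)⟩

theorem IsMatchingInvolution.mix [DecidableEq V] {w : V → V → ℕ} {σ τ : Equiv.Perm V}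
    (hσ : IsMatchingInvolution w σ) (hτ : IsMatchingInvolution w τ) {C : Finset V}
    (hσC : ∀ v ∈ C, σ v ∈ C) (hτC : ∀ v ∈ C, τ v ∈ C) :
    IsMatchingInvolution w (mixInvolutions σ τ C hσ.1 hτ.1 hσC hτC) := by
  constructor
  · intro v
    exact Function.Involutive.toPerm_involutive _ v
  · intro v hv
    rw [mixInvolutions_apply] at hv ⊢
    split_ifs with h
    · rw [if_pos h] at hv
      exact hτ.2 v hv
    · rw [if_neg h] at hv
      exact hσ.2 v hv

/-- The matching obtained by adding the pair `uv` to a matching that covers neither `u` nor `v`. -/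
theorem IsMatchingInvolution.mul_swap [DecidableEq V] {w : V → V → ℕ} (hw : ∀ a b, w a b = w b a)
    {σ : Equiv.Perm V} (hσ : IsMatchingInvolution w σ) {u v : V} (hu : σ u = u) (hv : σ v = v)
    (huv : 0 < w u v) : IsMatchingInvolution w (σ * Equiv.swap u v) := by
  have key : ∀ x, σ (Equiv.swap u v x) = if x = u then v else if x = v then u else σ x := by
    intro x
    rw [Equiv.swap_apply_def]
    split_ifs <;> simp [*]
  have hne : ∀ x, x ≠ u → σ x ≠ u := fun x hx h => hx (by rw [← hσ.1 x, h, hu])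
  have hne' : ∀ x, x ≠ v → σ x ≠ v := fun x hx h => hx (by rw [← hσ.1 x, h, hv])
  constructor
  · intro x
    simp only [Equiv.Perm.mul_apply, key]
    have := hne x
    have := hne' x
    have := hσ.1 x
    split_ifs <;> simp_all
  · intro x hx
    simp only [Equiv.Perm.mul_apply, key] at hx ⊢
    have := hσ.2 x
    have := hw u v
    split_ifs at hx ⊢ with h1 h2
    · rwa [h1]
    · rwa [h2, hw]
    · exact hσ.2 x hx

theorem card_filter_mixInvolutions_ne [DecidableEq V] {σ τ : Equiv.Perm V} {C : Finset V}
    (hσ : ∀ v, σ (σ v) = v) (hτ : ∀ v, τ (τ v) = v) (hσC : ∀ v ∈ C, σ v ∈ C)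
    (hτC : ∀ v ∈ C, τ v ∈ C) (S : Finset V) :
    (S.filter fun v => mixInvolutions σ τ C hσ hτ hσC hτC v ≠ v).card +
      ((S ∩ C).filter fun v => σ v ≠ v).card =
    (S.filter fun v => σ v ≠ v).card + ((S ∩ C).filter fun v => τ v ≠ v).card := by
  rw [← Finset.filter_mem_eq_inter, Finset.filter_filter, Finset.filter_filter]
  simp only [Finset.card_filter]
  rw [← Finset.sum_add_distrib, ← Finset.sum_add_distrib]
  refine Finset.sum_congr rfl fun v _ => ?_
  simp only [mixInvolutions_apply]
  by_cases h : v ∈ C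
  · simp only [h, if_true, true_and]
    rw [add_comm]
  · simp [h]

variable [Fintype V]

/-- The sum of `w v (σ v)` over all `v`: twice the weight of the matching encoded by `σ`. -/
def involutionWeight (w : V → V → ℕ) (σ : Equiv.Perm V) : ℕ := ∑ v, w v (σ v)

theorem even_involutionWeight {w : V → V → ℕ} (hw : ∀ a b, w a b = w b a) (hw0 : ∀ a, w a a = 0)
    {σ : Equiv.Perm V} (hσ : ∀ v, σ (σ v) = v) : Even (involutionWeight w σ) :=
  even_sum_involution hσ Finset.univ (fun _ _ => Finset.mem_univ _) w hw hw0

theorem sum_mixInvolutions_add [DecidableEq V] {M : Type*} [AddCommMonoid M] {σ τ : Equiv.Perm V}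
    {C : Finset V} (hσ : ∀ v, σ (σ v) = v) (hτ : ∀ v, τ (τ v) = v) (hσC : ∀ v ∈ C, σ v ∈ C)
    (hτC : ∀ v ∈ C, τ v ∈ C) (F : V → V → M) :
    ∑ v, F v (mixInvolutions σ τ C hσ hτ hσC hτC v) +
      ∑ v, F v (mixInvolutions τ σ C hτ hσ hτC hσC v) = ∑ v, F v (σ v) + ∑ v, F v (τ v) := by
  rw [← Finset.sum_add_distrib, ← Finset.sum_add_distrib]
  refine Finset.sum_congr rfl fun v _ => ?_
  simp only [mixInvolutions_apply]
  split_ifs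
  · rw [add_comm]
  · rfl

theorem exists_isMatchingInvolution_max [DecidableEq V] (w : V → V → ℕ)
    (p : Equiv.Perm V → Prop) (hp : p 1) (F : Equiv.Perm V → ℕ) :
    ∃ σ, IsMatchingInvolution w σ ∧ p σ ∧
      ∀ τ, IsMatchingInvolution w τ → p τ → F τ ≤ F σ := by
  classical
  obtain ⟨σ, hσ, h⟩ := Finset.exists_max_image
    (Finset.univ.filter fun σ => IsMatchingInvolution w σ ∧ p σ) F
    ⟨1, by simp [isMatchingInvolution_one, hp]⟩
  simp only [Finset.mem_filter, Finset.mem_univ, true_and, and_imp] at hσ h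
  exact ⟨σ, hσ.1, hσ.2, h⟩

/-- The truncated subtraction loses nothing here: matched pairs have weight at least `1`, and
unmatched points contribute `w v v = 0`. -/
theorem involutionWeight_eq_add_card [DecidableEq V] {w : V → V → ℕ} (hw0 : ∀ a, w a a = 0)
    (S : Finset V) {σ : Equiv.Perm V} (hσ : IsMatchingInvolution w σ) :
    involutionWeight w σ = involutionWeight (fun a b => w a b - if a ∈ S then 1 else 0) σ +
      (S.filter fun v => σ v ≠ v).card := by
  have : (S.filter fun v => σ v ≠ v).card =
      ∑ v, if v ∈ S ∧ σ v ≠ v then 1 else 0 := by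
    rw [← Finset.card_filter, ← Finset.filter_filter, Finset.filter_univ_mem]
  rw [this, involutionWeight, involutionWeight, ← Finset.sum_add_distrib]
  refine Finset.sum_congr rfl fun v _ => ?_
  by_cases h : σ v = v
  · simp [h, hw0]
  · have := hσ.2 v h
    by_cases hS : v ∈ S
    · simp only [hS, h, if_true, ne_eq, not_false_eq_true, and_self]
      omega
    · simp [hS]

theorem involutionWeight_mix_add [DecidableEq V] (w : V → V → ℕ) {σ τ : Equiv.Perm V}
    {C : Finset V} (hσ : ∀ v, σ (σ v) = v) (hτ : ∀ v, τ (τ v) = v) (hσC : ∀ v ∈ C, σ v ∈ C)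
    (hτC : ∀ v ∈ C, τ v ∈ C) :
    involutionWeight w (mixInvolutions σ τ C hσ hτ hσC hτC) +
      involutionWeight w (mixInvolutions τ σ C hτ hσ hτC hσC) =
    involutionWeight w σ + involutionWeight w τ :=
  sum_mixInvolutions_add hσ hτ hσC hτC w

/-- The objective that ranks matchings first by their weight for the weights `w`, lowered by `1` on
`S`, and then by the number of points of `S` they cover. -/
def lexObjective [DecidableEq V] (w : V → V → ℕ) (S : Finset V) (σ : Equiv.Perm V) : ℕ :=
  (Fintype.card V + 1) * involutionWeight (fun a b => w a b - if a ∈ S then 1 else 0) σ +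
    (S.filter fun v => σ v ≠ v).card

/-- The factor `Fintype.card V + 1` exceeds every possible number of covered points, so the second
criterion only breaks ties. -/
theorem lexObjective_le_iff [DecidableEq V] (w : V → V → ℕ) (S : Finset V) (σ τ : Equiv.Perm V) :
    lexObjective w S σ ≤ lexObjective w S τ ↔
      involutionWeight (fun a b => w a b - if a ∈ S then 1 else 0) σ <
        involutionWeight (fun a b => w a b - if a ∈ S then 1 else 0) τ ∨
      involutionWeight (fun a b => w a b - if a ∈ S then 1 else 0) σ =
        involutionWeight (fun a b => w a b - if a ∈ S then 1 else 0) τ ∧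
      (S.filter fun v => σ v ≠ v).card ≤ (S.filter fun v => τ v ≠ v).card := by
  have h1 : ∀ ρ : Equiv.Perm V, (S.filter fun v => ρ v ≠ v).card ≤ Fintype.card V :=
    fun ρ => Finset.card_le_univ _
  have hσ := h1 σ
  have hτ := h1 τ
  unfold lexObjective
  generalize involutionWeight _ σ = a
  generalize involutionWeight _ τ = b
  generalize (S.filter fun v => σ v ≠ v).card = c at *
  generalize (S.filter fun v => τ v ≠ v).card = d at *
  generalize Fintype.card V = n at *
  rcases lt_trichotomy a b with h | rfl | h
  · have : (n + 1) * (a + 1) ≤ (n + 1) * b := Nat.mul_le_mul_left _ h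
    simp only [h, true_or, iff_true]
    linarith
  · simp
  · have : (n + 1) * (b + 1) ≤ (n + 1) * a := Nat.mul_le_mul_left _ h
    constructor
    · intro h'
      linarith
    · omega

/-- Suppose that every point of `S` is missed by some matching of maximum weight, and that `R`
maximizes the lexicographic objective. If no such `R` misses two points `u`, `t` and none misses
`t`, `v`, for a point `t` of `S`, then none misses `u`, `v`. -/
theorem lexObjective_max_trans [DecidableEq V] {w : V → V → ℕ} (hw0 : ∀ a, w a a = 0)
    {S : Finset V} {u t v : V} (htS : t ∈ S)
    (hmiss : ∃ N, IsMatchingInvolution w N ∧ N t = t ∧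
      ∀ τ, IsMatchingInvolution w τ → involutionWeight w τ ≤ involutionWeight w N)
    (hut : ∀ R, IsMatchingInvolution w R →
      (∀ τ, IsMatchingInvolution w τ → lexObjective w S τ ≤ lexObjective w S R) →
      R u = u → R t = t → u = t)
    (htv : ∀ R, IsMatchingInvolution w R →
      (∀ τ, IsMatchingInvolution w τ → lexObjective w S τ ≤ lexObjective w S R) →
      R t = t → R v = v → t = v)
    {R : Equiv.Perm V} (hR : IsMatchingInvolution w R)
    (hmax : ∀ τ, IsMatchingInvolution w τ → lexObjective w S τ ≤ lexObjective w S R)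
    (hu : R u = u) (hv : R v = v) : u = v := by
  by_cases ht : R t = t
  · exact (hut R hR hmax hu ht).trans (htv R hR hmax ht hv)
  -- Exchange `R` and `N` on the alternating path `C` through `t`. Maximality of `N` gives `R'` at
  -- least the weight of `R`. Inside `S ∩ C`, `N` misses `t` and `R` misses at most one point, so
  -- `R'` covers no more of `S` than `R`. The lowered weight is the weight minus this coverage, so
  -- `R'` is again lexicographically maximal, and it misses `t`.
  obtain ⟨N, hN, hNt, hNmax⟩ := hmiss
  obtain ⟨C, hRC, hNC, htC, huniq⟩ := exists_invariant_at_most_one_fixed hR.1 hN.1 hNt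
  have hR' := hR.mix hN hRC hNC
  have hN' := hN.mix hR hNC hRC
  have hsum := involutionWeight_mix_add w hR.1 hN.1 hRC hNC
  have hcard := card_filter_mixInvolutions_ne hR.1 hN.1 hRC hNC S
  have hw1 := involutionWeight_eq_add_card hw0 S hR'
  have hw2 := involutionWeight_eq_add_card hw0 S hR
  set R' := mixInvolutions R N C hR.1 hN.1 hRC hNC with hR'def
  have hle := hNmax _ hN'
  have hc1 : ((S ∩ C).filter fun v => N v ≠ v).card < (S ∩ C).card :=
    Finset.card_lt_card (Finset.filter_ssubset.mpr ⟨t, by simp [htS, htC, hNt]⟩)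
  have hc2 : ((S ∩ C).filter fun v => R v = v).card ≤ 1 := by
    rw [Finset.card_le_one]
    intro a ha b hb
    simp only [Finset.mem_filter, Finset.mem_inter] at ha hb
    exact huniq a ha.1.2 b hb.1.2 ha.2 hb.2
  have hc3 := Finset.card_filter_add_card_filter_not (s := S ∩ C) (fun v => R v = v)
  have hR'max : ∀ τ, IsMatchingInvolution w τ → lexObjective w S τ ≤ lexObjective w S R' := by
    intro τ hτ
    refine (hmax τ hτ).trans ((lexObjective_le_iff w S R R').mpr ?_)
    simp only [ne_eq] at *
    omega
  have hR't : R' t = t := by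
    rw [hR'def, mixInvolutions_apply, if_pos htC, hNt]
  have hR'out : ∀ x, R x = x → x ∉ C → R' x = x := by
    intro x hx hxC
    rw [hR'def, mixInvolutions_apply, if_neg hxC, hx]
  -- If `u` and `v` are not both in `C`, one of them is still missed by `R'`, along with `t`. It
  -- then equals `t`, which contradicts that `R` covers `t`.
  by_cases huC : u ∈ C
  · by_cases hvC : v ∈ C
    · exact huniq u huC v hvC hu hv
    · have := htv R' hR' hR'max hR't (hR'out v hv hvC)
      exact absurd (this ▸ hv) ht
  · have := hut R' hR' hR'max (hR'out u hu huC) hR't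
    exact absurd (this ▸ hu) ht

/-- Adding the missed pair `uv` to `R` would not decrease the lowered weight, since lowered weights
are still nonnegative, and would cover two more points of `S`. -/
theorem lexObjective_max_of_pos [DecidableEq V] {w : V → V → ℕ} (hw : ∀ a b, w a b = w b a)
    (hw0 : ∀ a, w a a = 0) {S : Finset V} {u v : V} (huS : u ∈ S) (hvS : v ∈ S) (huv : 0 < w u v)
    {R : Equiv.Perm V} (hR : IsMatchingInvolution w R)
    (hmax : ∀ τ, IsMatchingInvolution w τ → lexObjective w S τ ≤ lexObjective w S R)
    (hu : R u = u) (hv : R v = v) : u = v := by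
  exfalso
  have hne : u ≠ v := by
    rintro rfl
    simp [hw0] at huv
  have h := hmax _ (hR.mul_swap hw hu hv huv)
  have hap : ∀ x, (R * Equiv.swap u v) x = if x = u then v else if x = v then u else R x := by
    intro x
    rw [Equiv.Perm.mul_apply, Equiv.swap_apply_def]
    split_ifs <;> simp [*]
  have h1 : involutionWeight (fun a b => w a b - if a ∈ S then 1 else 0) R ≤
      involutionWeight (fun a b => w a b - if a ∈ S then 1 else 0) (R * Equiv.swap u v) := by
    refine Finset.sum_le_sum fun x _ => ?_
    rw [hap]
    split_ifs with h1 h2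
    · simp [h1, hu, hw0]
    · simp [h2, hv, hw0]
    · simp
  have h2 : (S.filter fun v => R v ≠ v).card <
      (S.filter fun x => (R * Equiv.swap u v) x ≠ x).card := by
    refine Finset.card_lt_card ⟨?_, ?_⟩
    · intro x hx
      simp only [Finset.mem_filter, hap] at hx ⊢
      refine ⟨hx.1, ?_⟩
      rw [if_neg, if_neg]
      · exact hx.2
      · rintro rfl
        exact hx.2 hv
      · rintro rfl
        exact hx.2 hu
    · intro hsub
      have := @hsub u (by simp [hap, huS, hne.symm])
      simp [hu] at this
  rw [lexObjective_le_iff] at h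
  omega

end WeightedMatching

/-! ### Edmonds' matching polytope theorem for integral weights. -/

section MatchingPolytope

variable {V : Type*} [Fintype V] [DecidableEq V]

/-- The graph of the pairs of positive weight. -/
def supportGraph (w : V → V → ℕ) (hw : ∀ a b, w a b = w b a) (hw0 : ∀ a, w a a = 0) :
    SimpleGraph V where
  Adj a b := 0 < w a b
  symm := ⟨fun a b h => by rwa [hw]⟩
  loopless := ⟨fun a h => by simp [hw0] at h⟩

open Classical in
theorem sum_mul_eq_sum_tsub_mul_add (w : V → V → ℕ) (S : Finset V) (g : V → V → ℝ) :
    ∑ a, ∑ b, (w a b : ℝ) * g a b =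
      ∑ a, ∑ b, ((w a b - if a ∈ S then 1 else 0 : ℕ) : ℝ) * g a b +
        ∑ a, ∑ b, if a ∈ S ∧ 0 < w a b then g a b else 0 := by
  simp only [← Finset.sum_add_distrib]
  refine Finset.sum_congr rfl fun a _ => Finset.sum_congr rfl fun b _ => ?_
  by_cases ha : a ∈ S
  · rcases Nat.eq_zero_or_pos (w a b) with h | h
    · simp [h]
    · simp only [ha, h, if_true, and_self]
      rw [Nat.cast_sub h]
      push_cast
      ring
  · simp [ha]

theorem sum_mul_eq_sum_tsub_star_mul_add (w : V → V → ℕ) (hw : ∀ a b, w a b = w b a)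
    (hw0 : ∀ a, w a a = 0) (u : V) (g : V → V → ℝ) :
    ∑ a, ∑ b, (w a b : ℝ) * g a b =
      ∑ a, ∑ b, ((w a b - if a = u ∨ b = u then 1 else 0 : ℕ) : ℝ) * g a b +
        ∑ b with 0 < w u b, (g u b + g b u) := by
  have h1 : ∑ b with 0 < w u b, (g u b + g b u) =
      ∑ a, ∑ b, ((if a = u then if 0 < w a b then g a b else 0 else 0) +
        if b = u then if 0 < w a b then g a b else 0 else 0) := by
    simp only [Finset.sum_add_distrib]
    congr 1
    · rw [Finset.sum_filter, eq_comm]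
      refine (Finset.sum_eq_single u (fun a _ h => by simp [h]) (by simp)).trans ?_
      simp
    · rw [Finset.sum_filter]
      refine Finset.sum_congr rfl fun a _ => ?_
      rw [Finset.sum_ite_eq' Finset.univ u]
      simp [hw u a]
  rw [h1]
  simp only [← Finset.sum_add_distrib]
  refine Finset.sum_congr rfl fun a _ => Finset.sum_congr rfl fun b _ => ?_
  rcases Nat.eq_zero_or_pos (w a b) with h | h
  · simp [h]
  · by_cases ha : a = u
    · have hb : b ≠ u := by
        rintro rfl
        simp [ha, hw0] at h
      simp only [ha, hb, if_true, or_false, if_false]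
      rw [ha] at h
      rw [Nat.cast_sub h, if_pos h]
      push_cast
      ring
    · by_cases hb : b = u
      · simp only [ha, hb, if_true, or_true, if_false]
        rw [hb] at h
        rw [Nat.cast_sub h, if_pos h]
        push_cast
        ring
      · simp [ha, hb]

/-- Only the two orientations of the pair formed by `u` and `σ u` are lowered, each by a full unit.
-/
theorem involutionWeight_eq_star_add_two {w : V → V → ℕ} (hw0 : ∀ a, w a a = 0) {u : V}
    {σ : Equiv.Perm V} (hσ : IsMatchingInvolution w σ) (hu : σ u ≠ u) :
    involutionWeight w σ =
      involutionWeight (fun a b => w a b - if a = u ∨ b = u then 1 else 0) σ + 2 := by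
  have h2 : (2 : ℕ) = ∑ v, ((if v = u then 1 else 0) + if v = σ u then 1 else 0) := by
    simp [Finset.sum_add_distrib]
  rw [h2, involutionWeight, involutionWeight, ← Finset.sum_add_distrib]
  refine Finset.sum_congr rfl fun v _ => ?_
  have hiff : v = σ u ↔ σ v = u := by
    constructor
    · rintro rfl
      exact hσ.1 u
    · rintro rfl
      exact (hσ.1 v).symm
  simp only [hiff]
  by_cases hv : σ v = v
  · have hvu : v ≠ u := by
      rintro rfl
      exact hu hv
    simp [hv, hvu, hw0]
  · have := hσ.2 v hv
    by_cases h3 : v = u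
    · have h4 : σ v ≠ u := by rwa [h3]
      simp only [h3, true_or, if_true]
      rw [h3] at this
      rw [h3] at h4
      simp only [h4, if_false]
      omega
    · by_cases h4 : σ v = u
      · simp only [h3, h4, or_true, if_true, if_false]
        rw [h4] at this
        omega
      · simp [h3, h4]

open Classical in
/-- **Edmonds' matching polytope theorem**, for integral weights: if `g` satisfies the star and the
odd set inequalities, then every weighting `w` has a matching whose weight is at least
`∑ w a b * g a b`. All sums run over ordered pairs. -/
theorem exists_isMatchingInvolution_sum_le {g : V → V → ℝ}
    (hstar : ∀ (u : V) (S : Finset V), u ∉ S → ∑ b ∈ S, (g u b + g b u) ≤ 2)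
    (hset : ∀ (H : SimpleGraph V) (S : Finset V), (∀ a b, H.Adj a b → a ∈ S) →
      ∑ a, ∑ b, (if H.Adj a b then g a b else 0) ≤ ((2 * (S.card / 2) : ℕ) : ℝ))
    (w : V → V → ℕ) (hw : ∀ a b, w a b = w b a) (hw0 : ∀ a, w a a = 0) :
    ∃ σ, IsMatchingInvolution w σ ∧
      ∑ a, ∑ b, (w a b : ℝ) * g a b ≤ (involutionWeight w σ : ℝ) := by
  induction hN : ∑ a, ∑ b, w a b using Nat.strong_induction_on generalizing w with
  | _ N ih =>
  by_cases hzero : ∀ a b, w a b = 0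
  · refine ⟨1, isMatchingInvolution_one w, ?_⟩
    simp [hzero]
  push Not at hzero
  obtain ⟨a₀, b₀, hab⟩ := hzero
  have hab : 0 < w a₀ b₀ := Nat.pos_of_ne_zero hab
  have hlt : ∀ w' : V → V → ℕ, (∀ a b, w' a b ≤ w a b) → ∀ a b, w' a b < w a b →
      ∑ a, ∑ b, w' a b < N := by
    intro w' hle a b hlt
    rw [← hN]
    refine Finset.sum_lt_sum (fun a _ => Finset.sum_le_sum fun b _ => hle a b)
      ⟨a, Finset.mem_univ a, ?_⟩
    exact Finset.sum_lt_sum (fun b _ => hle a b) ⟨b, Finset.mem_univ b, hlt⟩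
  -- First case: some non-isolated `u` is covered by all matchings of maximum weight. Lowering the
  -- star of `u` by `1` then lowers the doubled optimum by at least `2`, which pays for the star
  -- inequality.
  by_cases hcase : ∃ u v, 0 < w u v ∧ ∀ σ, IsMatchingInvolution w σ →
      (∀ τ, IsMatchingInvolution w τ → involutionWeight w τ ≤ involutionWeight w σ) → σ u ≠ u
  · obtain ⟨u, v, huv, hu⟩ := hcase
    have hle : ∀ a b, (w a b - if a = u ∨ b = u then 1 else 0) ≤ w a b := fun a b => Nat.sub_le _ _
    obtain ⟨σ, hσ, hσw⟩ := ih _ (hlt _ hle u v (by simpa using huv))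
      (fun a b => w a b - if a = u ∨ b = u then 1 else 0)
      (fun a b => by simp only [hw a b, or_comm]) (fun a => by simp [hw0]) rfl
    have hσ' := hσ.mono hle
    have hsum := sum_mul_eq_sum_tsub_star_mul_add w hw hw0 u g
    have hst := hstar u (Finset.univ.filter fun b => 0 < w u b) (by simp [hw0])
    by_cases hσu : σ u = u
    · obtain ⟨ρ, hρ, -, hmax⟩ := exists_isMatchingInvolution_max w (fun _ => True) trivial
        (involutionWeight w)
      refine ⟨ρ, hρ, ?_⟩
      have h1 : involutionWeight w σ < involutionWeight w ρ := by
        by_contra! hcon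
        exact hu σ hσ' (fun τ hτ => (hmax τ hτ trivial).trans hcon) hσu
      -- Doubled weights are even, so the strict inequality is a gap of at least `2`.
      obtain ⟨x, hx⟩ := even_involutionWeight hw hw0 hσ'.1
      obtain ⟨y, hy⟩ := even_involutionWeight hw hw0 hρ.1
      have h2 : involutionWeight (fun a b => w a b - if a = u ∨ b = u then 1 else 0) σ ≤
        involutionWeight w σ := Finset.sum_le_sum fun v _ => hle _ _
      have h3 : involutionWeight (fun a b => w a b - if a = u ∨ b = u then 1 else 0) σ + 2 ≤
        involutionWeight w ρ := by omega
      have h4 : (involutionWeight (fun a b => w a b - if a = u ∨ b = u then 1 else 0) σ : ℝ) + 2 ≤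
        involutionWeight w ρ := by exact_mod_cast h3
      linarith
    · refine ⟨σ, hσ', ?_⟩
      rw [involutionWeight_eq_star_add_two hw0 hσ' hσu]
      push_cast at hσw hsum ⊢
      linarith
  -- Second case: every non-isolated vertex is missed by some matching of maximum weight. All
  -- weights in one component `S` of the support are lowered by `1`. As in Gallai's lemma, a
  -- lexicographically maximal matching misses at most one vertex of `S`, and this pays for the
  -- inequality of `S`.
  · push Not at hcase
    set S : Finset V := Finset.univ.filter ((supportGraph w hw hw0).Reachable a₀) with hS
    have hmemS : ∀ v, v ∈ S ↔ (supportGraph w hw hw0).Reachable a₀ v := by simp [hS]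
    have hadjS : ∀ a b, 0 < w a b → a ∈ S → b ∈ S := by
      intro a b h ha
      rw [hmemS] at ha ⊢
      exact ha.trans (SimpleGraph.Adj.reachable (G := supportGraph w hw hw0) h)
    have ha₀ : a₀ ∈ S := by simp [hS]
    have hle : ∀ a b, (w a b - if a ∈ S then 1 else 0) ≤ w a b := fun a b => Nat.sub_le _ _
    have hsymm : ∀ a b, (w a b - if a ∈ S then 1 else 0) = (w b a - if b ∈ S then 1 else 0) := by
      intro a b
      rcases Nat.eq_zero_or_pos (w a b) with h | h
      · simp [h, ← hw a b]
      · have : a ∈ S ↔ b ∈ S := ⟨hadjS a b h, hadjS b a (hw a b ▸ h)⟩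
        simp [this, hw a b]
    obtain ⟨σ, hσ, hσw⟩ := ih _ (hlt _ hle a₀ b₀ (by simpa [ha₀] using hab))
      (fun a b => w a b - if a ∈ S then 1 else 0) hsymm (fun a => by simp [hw0]) rfl
    obtain ⟨R, hR, -, hmax'⟩ := exists_isMatchingInvolution_max w (fun _ => True) trivial
      (lexObjective w S)
    have hmax := fun τ hτ => hmax' τ hτ trivial
    -- Induction along a walk from `u`: the last edge is `lexObjective_max_of_pos`, and
    -- `lexObjective_max_trans` joins it to the rest.
    have huniq : ∀ u ∈ S, ∀ v, (supportGraph w hw hw0).Reachable u v →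
        ∀ R, IsMatchingInvolution w R →
        (∀ τ, IsMatchingInvolution w τ → lexObjective w S τ ≤ lexObjective w S R) →
        R u = u → R v = v → u = v := by
      intro u hu v huv
      rw [SimpleGraph.reachable_iff_reflTransGen] at huv
      induction huv with
      | refl => exact fun _ _ _ _ _ => rfl
      | @tail t v hut htv iht =>
        have htS : t ∈ S := by
          rw [hmemS] at hu ⊢
          exact hu.trans ((SimpleGraph.reachable_iff_reflTransGen _ _).mpr hut)
        intro R hR hmax hu' hv'
        obtain ⟨N, hN, hN1, hN2⟩ := hcase t v htv
        exact lexObjective_max_trans hw0 htS ⟨N, hN, hN2, hN1⟩ iht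
          (fun R hR hmax => lexObjective_max_of_pos hw hw0 htS (hadjS t v htv htS) htv hR hmax)
          hR hmax hu' hv'
    refine ⟨R, hR, ?_⟩
    have hRS : ∀ v ∈ S, R v ∈ S := by
      intro v hv
      by_cases h : R v = v
      · rwa [h]
      · exact hadjS _ _ (hR.2 v h) hv
    have hfix : (S.filter fun v => R v = v).card ≤ 1 := by
      rw [Finset.card_le_one]
      intro a ha b hb
      simp only [Finset.mem_filter] at ha hb
      refine huniq a ha.1 b ?_ R hR hmax ha.2 hb.2
      exact ((hmemS a).mp ha.1).symm.trans ((hmemS b).mp hb.1)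
    have hcov : 2 * (S.card / 2) ≤ (S.filter fun v => R v ≠ v).card := by
      obtain ⟨x, hx⟩ := even_card_filter_apply_ne hR.1 S hRS
      have := Finset.card_filter_add_card_filter_not (s := S) (fun v => R v = v)
      simp only [ne_eq] at hx ⊢
      omega
    have hsum := sum_mul_eq_sum_tsub_mul_add w S g
    have hedge := hset
      { Adj := fun a b => a ∈ S ∧ 0 < w a b
        symm := ⟨fun a b h => ⟨hadjS a b h.2 h.1, hw a b ▸ h.2⟩⟩
        loopless := ⟨fun a h => by simp [hw0] at h⟩ } S (fun a b h => h.1)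
    have hlex := (lexObjective_le_iff w S σ R).mp (hmax σ (hσ.mono hle))
    have h1 : involutionWeight (fun a b => w a b - if a ∈ S then 1 else 0) σ ≤
        involutionWeight (fun a b => w a b - if a ∈ S then 1 else 0) R := by
      rcases hlex with h | h
      · exact h.le
      · exact h.1.le
    have h2 : involutionWeight (fun a b => w a b - if a ∈ S then 1 else 0) σ + 2 * (S.card / 2) ≤
        involutionWeight w R := by
      rw [involutionWeight_eq_add_card hw0 S hR]
      exact add_le_add h1 hcov
    have h3 : (involutionWeight (fun a b => w a b - if a ∈ S then 1 else 0) σ : ℝ) +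
        ((2 * (S.card / 2) : ℕ) : ℝ) ≤ involutionWeight w R := by exact_mod_cast h2
    rw [hsum]
    refine le_trans (add_le_add hσw ?_) h3
    refine le_trans (le_of_eq ?_) hedge
    refine Finset.sum_congr rfl fun a _ => Finset.sum_congr rfl fun b _ => ?_
    by_cases h : a ∈ S ∧ 0 < w a b
    · exact (if_pos h).trans (if_pos h).symm
    · exact (if_neg h).trans (if_neg h).symm

open Classical in
/-- The matching polytope theorem for matchings with at most `k` edges. -/
theorem exists_isMatchingInvolution_card_le_sum_le {g : V → V → ℝ} {k : ℕ}
    (hstar : ∀ (u : V) (S : Finset V), u ∉ S → ∑ b ∈ S, (g u b + g b u) ≤ 2)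
    (hset : ∀ (H : SimpleGraph V) (S : Finset V), (∀ a b, H.Adj a b → a ∈ S) →
      ∑ a, ∑ b, (if H.Adj a b then g a b else 0) ≤ ((2 * (S.card / 2) : ℕ) : ℝ))
    (hcard : ∀ H : SimpleGraph V,
      ∑ a, ∑ b, (if H.Adj a b then g a b else 0) ≤ ((2 * k : ℕ) : ℝ))
    (w : V → V → ℕ) (hw : ∀ a b, w a b = w b a) (hw0 : ∀ a, w a a = 0) :
    ∃ σ, IsMatchingInvolution w σ ∧ (Finset.univ.filter fun v => σ v ≠ v).card ≤ 2 * k ∧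
      ∑ a, ∑ b, (w a b : ℝ) * g a b ≤ (involutionWeight w σ : ℝ) := by
  induction hN : ∑ a, ∑ b, w a b using Nat.strong_induction_on generalizing w with
  | _ N ih =>
  -- `M` is taken among the matchings of maximum weight so as to cover the fewest points. If it has
  -- at most `k` edges, the theorem without cardinality bound suffices; otherwise all weights are
  -- lowered by `1`.
  have hex : ∃ c M, IsMatchingInvolution w M ∧
      (Finset.univ.filter fun v => M v ≠ v).card = c ∧
      ∀ τ, IsMatchingInvolution w τ → involutionWeight w τ ≤ involutionWeight w M := by
    obtain ⟨M, hM, -, hmax⟩ := exists_isMatchingInvolution_max w (fun _ => True) trivial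
      (involutionWeight w)
    exact ⟨_, M, hM, rfl, fun τ hτ => hmax τ hτ trivial⟩
  obtain ⟨M, hM, hMc, hMmax⟩ := Nat.find_spec hex
  have hMmin := fun c (hc : c < Nat.find hex) => Nat.find_min hex hc
  rw [← hMc] at hMmin
  clear hMc
  by_cases hMk : (Finset.univ.filter fun v => M v ≠ v).card ≤ 2 * k
  · refine ⟨M, hM, hMk, ?_⟩
    obtain ⟨σ, hσ, hσw⟩ := exists_isMatchingInvolution_sum_le hstar hset w hw hw0
    exact hσw.trans (by exact_mod_cast hMmax σ hσ)
  obtain ⟨a₀, ha₀⟩ : ∃ a, M a ≠ a := by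
    by_contra! hcon
    simp [hcon] at hMk
  have hab := hM.2 a₀ ha₀
  have hle : ∀ a b, (w a b - if a ∈ (Finset.univ : Finset V) then 1 else 0) ≤ w a b :=
    fun a b => Nat.sub_le _ _
  obtain ⟨σ, hσ, hσk, hσw⟩ := ih (∑ a, ∑ b, (w a b - if a ∈ (Finset.univ : Finset V) then 1 else 0))
    (by
      rw [← hN]
      refine Finset.sum_lt_sum (fun a _ => Finset.sum_le_sum fun b _ => hle a b)
        ⟨a₀, Finset.mem_univ _, ?_⟩
      refine Finset.sum_lt_sum (fun b _ => hle a₀ b) ⟨M a₀, Finset.mem_univ _, ?_⟩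
      simpa using hab)
    (fun a b => w a b - if a ∈ (Finset.univ : Finset V) then 1 else 0)
    (fun a b => by simp [hw a b]) (fun a => by simp [hw0]) rfl
  obtain ⟨R, hR, hRk, hmax⟩ := exists_isMatchingInvolution_max w
    (fun σ => (Finset.univ.filter fun v => σ v ≠ v).card ≤ 2 * k) (by simp)
    (lexObjective w Finset.univ)
  have hRw := involutionWeight_eq_add_card hw0 Finset.univ hR
  obtain ⟨y, hy⟩ := even_card_filter_apply_ne hR.1 Finset.univ fun _ _ => Finset.mem_univ _
  -- If `R` had fewer than `k` edges, exchange it with the larger `M` on a set where `M` covers two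
  -- more points. Maximality of `R` and parity show that `R'` does not outweigh `R`, so `M'` weighs
  -- at least as much as `M` with fewer covered points, against the choice of `M`.
  have hRcard : (Finset.univ.filter fun v => R v ≠ v).card = 2 * k := by
    by_contra hne
    obtain ⟨C, hMC, hRC, hC⟩ := exists_invariant_two_more_fixed hM.1 hR.1 (by omega)
    have hR' := hR.mix hM hRC hMC
    have hM' := hM.mix hR hMC hRC
    have hsum := involutionWeight_mix_add w hR.1 hM.1 hRC hMC
    have hc1 := card_filter_mixInvolutions_ne hR.1 hM.1 hRC hMC Finset.univ
    have hc2 := card_filter_mixInvolutions_ne hM.1 hR.1 hMC hRC Finset.univ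
    rw [Finset.univ_inter] at hc1 hc2
    have hw1 := involutionWeight_eq_add_card hw0 Finset.univ hR'
    have hlex := (lexObjective_le_iff _ _ _ _).mp (hmax _ hR' (by omega))
    obtain ⟨p, hp⟩ := even_involutionWeight hw hw0 hR.1
    obtain ⟨q, hq⟩ := even_involutionWeight hw hw0 hR'.1
    refine hMmin _ ?_ ⟨_, hM', rfl, fun τ hτ => (hMmax τ hτ).trans ?_⟩
    · omega
    · omega
  refine ⟨R, hR, hRk, ?_⟩
  have hsum := sum_mul_eq_sum_tsub_mul_add w Finset.univ g
  have hedge := hcard (supportGraph w hw hw0)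
  have hlex := (lexObjective_le_iff w Finset.univ σ R).mp (hmax σ (hσ.mono hle) hσk)
  have h2 : involutionWeight (fun a b => w a b - if a ∈ (Finset.univ : Finset V) then 1 else 0) σ +
      2 * k ≤ involutionWeight w R := by
    omega
  have h3 : (involutionWeight
      (fun a b => w a b - if a ∈ (Finset.univ : Finset V) then 1 else 0) σ : ℝ) +
      ((2 * k : ℕ) : ℝ) ≤ involutionWeight w R := by exact_mod_cast h2
  rw [hsum]
  refine le_trans (add_le_add hσw ?_) h3
  refine le_trans (le_of_eq ?_) hedge
  exact Finset.sum_congr rfl fun a _ => Finset.sum_congr rfl fun b _ => if_congr (by simp [supportGraph]) rfl rfl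

end MatchingPolytope

noncomputable section

namespace WeightedGraph

/-! ### Passage to real weights and to `maxMatchingWeight`. -/

section RealWeights

variable {V : Type*}

theorem adjacency_symm (G : WeightedGraph V) (a b : V) : G.adjacency a b = G.adjacency b a := by
  have := congrFun (congrFun G.adjacency_isHermitian b) a
  simpa using this

theorem adjacency_self (G : WeightedGraph V) (a : V) : G.adjacency a a = 0 := by
  simp [adjacency]

theorem adjacency_nonneg (G : WeightedGraph V) (a b : V) : 0 ≤ G.adjacency a b := by
  simp only [adjacency, Matrix.of_apply]
  split_ifs with h
  · exact (G.weight_pos _ h).le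
  · exact le_rfl

theorem adj_of_adjacency_ne_zero (G : WeightedGraph V) {a b : V} (h : G.adjacency a b ≠ 0) :
    G.graph.Adj a b := by
  by_contra hab
  simp [adjacency, hab] at h

theorem adjacency_of_adj (G : WeightedGraph V) {a b : V} (h : G.graph.Adj a b) :
    G.adjacency a b = G.weight s(a, b) := by
  simp [adjacency, h]

variable [Fintype V] [DecidableEq V]

theorem sum_adjacency_involution_le (G : WeightedGraph V) {k : ℕ} {σ : Equiv.Perm V}
    (hσ : ∀ v, σ (σ v) = v) (hadj : ∀ v, σ v ≠ v → G.graph.Adj v (σ v))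
    (hk : (Finset.univ.filter fun v => σ v ≠ v).card ≤ 2 * k) :
    ∑ v, G.adjacency v (σ v) ≤ 2 * G.maxMatchingWeight k := by
  classical
  set T := Finset.univ.filter fun v => σ v ≠ v with hT
  set R : Finset (Sym2 V) := T.image fun v => s(v, σ v) with hR
  -- Each matching edge arises from both of its ends; hence the factors `2`.
  have hfib : ∀ e ∈ R, (T.filter fun v => s(v, σ v) = e).card = 2 := by
    intro e he
    obtain ⟨v, hv, rfl⟩ := Finset.mem_image.mp he
    have hv' : σ v ≠ v := by simpa [hT] using hv
    have : (T.filter fun u => s(u, σ u) = s(v, σ v)) = {v, σ v} := by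
      ext u
      simp only [hT, Finset.mem_filter, Finset.mem_univ, true_and, Sym2.eq_iff,
        Finset.mem_insert, Finset.mem_singleton]
      constructor
      · rintro ⟨-, h | h⟩
        · exact Or.inl h.1
        · exact Or.inr h.1
      · rintro (rfl | rfl)
        · exact ⟨hv', Or.inl ⟨rfl, rfl⟩⟩
        · rw [hσ]
          exact ⟨hv'.symm, Or.inr ⟨rfl, rfl⟩⟩
    rw [this, Finset.card_pair hv'.symm]
  have hcard : T.card = 2 * R.card := by
    rw [Finset.card_eq_sum_card_image (fun v => s(v, σ v)) T, Finset.sum_congr rfl hfib]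
    simp [mul_comm, hR]
  have hsum : ∑ v, G.adjacency v (σ v) = 2 * ∑ e ∈ R, G.weight e := by
    have h1 : ∑ v, G.adjacency v (σ v) = ∑ v ∈ T, G.weight s(v, σ v) := by
      rw [hT, Finset.sum_filter]
      refine Finset.sum_congr rfl fun v _ => ?_
      split_ifs with h
      · exact G.adjacency_of_adj (hadj v h)
      · rw [not_not.mp h, adjacency_self]
    rw [h1, Finset.sum_comp G.weight (fun v => s(v, σ v)), Finset.mul_sum]
    refine Finset.sum_congr rfl fun e he => ?_
    rw [hfib e he]
    simp
  have hmem : R ∈ G.matchings k := by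
    simp only [matchings, Finset.mem_filter, Finset.mem_powerset]
    refine ⟨?_, ?_, by omega⟩
    · intro e he
      obtain ⟨v, hv, rfl⟩ := Finset.mem_image.mp he
      simpa using hadj v (by simpa [hT] using hv)
    · intro v
      rw [Finset.card_le_one]
      have key : ∀ e ∈ R, v ∈ e → e = s(v, σ v) := by
        intro e he hve
        obtain ⟨u, hu, rfl⟩ := Finset.mem_image.mp he
        rcases Sym2.mem_iff.mp hve with rfl | rfl
        · rfl
        · rw [hσ, Sym2.eq_swap]
      intro e he e' he'
      obtain ⟨he, hve⟩ := (@Finset.mem_filter _ _ (_) _ _).mp he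
      obtain ⟨he', hve'⟩ := (@Finset.mem_filter _ _ (_) _ _).mp he'
      rw [key e he hve, key e' he' hve']
  rw [hsum]
  have := Finset.le_sup' (fun R => ∑ e ∈ R, G.weight e) hmem
  unfold maxMatchingWeight
  linarith

open Classical in
/-- **Edmonds' matching polytope theorem** for matchings with at most `k` edges, with real weights:
a function satisfying the star, odd set and cardinality inequalities satisfies the inequality given
by the maximum weight of a matching. -/
theorem sum_adjacency_mul_le_maxMatchingWeight (G : WeightedGraph V) {g : V → V → ℝ} {k : ℕ}
    (hstar : ∀ (u : V) (S : Finset V), u ∉ S → ∑ b ∈ S, (g u b + g b u) ≤ 2)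
    (hset : ∀ (H : SimpleGraph V) (S : Finset V), (∀ a b, H.Adj a b → a ∈ S) →
      ∑ a, ∑ b, (if H.Adj a b then g a b else 0) ≤ ((2 * (S.card / 2) : ℕ) : ℝ))
    (hcard : ∀ H : SimpleGraph V,
      ∑ a, ∑ b, (if H.Adj a b then g a b else 0) ≤ ((2 * k : ℕ) : ℝ)) :
    ∑ a, ∑ b, G.adjacency a b * g a b ≤ 2 * G.maxMatchingWeight k := by
  -- The integral theorem is applied to the weights `⌊A x⌋`, divided by `x`; these tend to the real
  -- weights as `x → ∞`.
  have hx : ∀ x : ℝ, 0 < x →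
      ∑ a, ∑ b, ((⌊G.adjacency a b * x⌋₊ : ℝ) / x) * g a b ≤ 2 * G.maxMatchingWeight k := by
    intro x hx
    obtain ⟨σ, hσ, hσk, hσw⟩ := exists_isMatchingInvolution_card_le_sum_le hstar hset hcard
      (fun a b => ⌊G.adjacency a b * x⌋₊) (fun a b => by rw [adjacency_symm])
      (fun a => by simp [adjacency_self])
    have h1 : (involutionWeight (fun a b => ⌊G.adjacency a b * x⌋₊) σ : ℝ) ≤
        (∑ v, G.adjacency v (σ v)) * x := by
      rw [involutionWeight, Nat.cast_sum, Finset.sum_mul]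
      exact Finset.sum_le_sum fun v _ =>
        Nat.floor_le (mul_nonneg (G.adjacency_nonneg _ _) hx.le)
    have h2 := G.sum_adjacency_involution_le hσ.1 (fun v hv => by
      refine G.adj_of_adjacency_ne_zero fun h0 => ?_
      have := hσ.2 v hv
      simp [h0] at this) hσk
    have h3 : ∑ a, ∑ b, ((⌊G.adjacency a b * x⌋₊ : ℝ) / x) * g a b =
        (∑ a, ∑ b, (⌊G.adjacency a b * x⌋₊ : ℝ) * g a b) / x := by
      simp only [Finset.sum_div]
      exact Finset.sum_congr rfl fun a _ => Finset.sum_congr rfl fun b _ => by ring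
    rw [h3, div_le_iff₀ hx]
    exact hσw.trans (h1.trans (mul_le_mul_of_nonneg_right h2 hx.le))
  have hlim : Filter.Tendsto
      (fun x : ℝ => ∑ a, ∑ b, ((⌊G.adjacency a b * x⌋₊ : ℝ) / x) * g a b) Filter.atTop
      (nhds (∑ a, ∑ b, G.adjacency a b * g a b)) :=
    tendsto_finsetSum _ fun a _ => tendsto_finsetSum _ fun b _ =>
      (tendsto_nat_floor_mul_div_atTop (G.adjacency_nonneg a b)).mul_const _
  exact le_of_tendsto hlim ((Filter.eventually_gt_atTop 0).mono hx)

theorem sum_adjacency_eq_two_mul_totalWeight (G : WeightedGraph V) :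
    ∑ a, ∑ b, G.adjacency a b = 2 * G.totalWeight := by
  classical
  have h1 : ∑ a, ∑ b, G.adjacency a b =
      ∑ d : G.graph.Dart, G.weight d.edge := by
    rw [← Finset.sum_product' Finset.univ Finset.univ fun a b => G.adjacency a b]
    rw [← Finset.sum_filter_of_ne (p := fun x : V × V => G.graph.Adj x.1 x.2)
      (fun x _ h => G.adj_of_adjacency_ne_zero h)]
    symm
    refine Finset.sum_bij' (fun d _ => d.toProd) (fun x hx => ⟨x, by simpa using hx⟩)
      ?_ ?_ ?_ ?_ ?_
    · intro d _
      simp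
    · intro x _
      simp
    · intro d _
      rfl
    · intro x _
      rfl
    · intro d _
      exact (G.adjacency_of_adj d.adj).symm
  have h2 : ∀ e ∈ G.graph.edgeFinset,
      ∑ d : G.graph.Dart with d.edge = e, G.weight d.edge = 2 * G.weight e := by
    intro e he
    rw [Finset.sum_congr rfl fun d hd => by rw [(Finset.mem_filter.mp hd).2], Finset.sum_const,
      G.graph.dart_edge_fiber_card e (by simpa using he)]
    simp
  rw [h1, totalWeight, Finset.mul_sum, ← Finset.sum_congr rfl h2]
  exact (Finset.sum_fiberwise_of_maps_to (fun d _ => by simp) _).symm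

end RealWeights

end WeightedGraph

/-! ### Extreme eigenvalues and quadratic forms. -/

section RayleighQuotient

theorem dotProduct_self_pos_of_ne_zero {ι : Type*} [Fintype ι] {x : ι → ℝ} (hx : x ≠ 0) : 0 < x ⬝ᵥ x := by
  have := Matrix.dotProduct_star_self_pos_iff (v := x)
  simpa [hx] using this

variable {ι : Type*} [Fintype ι] [DecidableEq ι]

theorem mem_eigs_iff_exists {M : Matrix ι ι ℝ} {μ : ℝ} :
    μ ∈ eigs M ↔ ∃ x : ι → ℝ, x ≠ 0 ∧ M.mulVec x = μ • x := by
  constructor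
  · intro h
    obtain ⟨x, hx⟩ := Module.End.HasEigenvalue.exists_hasEigenvector h
    exact ⟨x, hx.2, by simpa using hx.apply_eq_smul⟩
  · rintro ⟨x, hx, h⟩
    exact Module.End.hasEigenvalue_of_hasEigenvector
      (x := x) ⟨Module.End.mem_eigenspace_iff.mpr (by simpa using h), hx⟩

theorem le_of_mem_eigs {M : Matrix ι ι ℝ} {c μ : ℝ} (h : ∀ x, x ⬝ᵥ M.mulVec x ≤ c * (x ⬝ᵥ x))
    (hμ : μ ∈ eigs M) : μ ≤ c := by
  obtain ⟨x, hx, hxμ⟩ := mem_eigs_iff_exists.mp hμ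
  have := h x
  rw [hxμ, dotProduct_smul, smul_eq_mul] at this
  exact le_of_mul_le_mul_right this (dotProduct_self_pos_of_ne_zero hx)

theorem dotProduct_mulVec_le_of_eigs_le {M : Matrix ι ι ℝ} (hM : M.IsHermitian) {c : ℝ}
    (h : ∀ μ ∈ eigs M, μ ≤ c) (x : ι → ℝ) : x ⬝ᵥ M.mulVec x ≤ c * (x ⬝ᵥ x) := by
  have hc : (c • (1 : Matrix ι ι ℝ)).IsHermitian := by
    simp [Matrix.IsHermitian]
  have hpos : (c • (1 : Matrix ι ι ℝ) - M).PosSemidef := by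
    rw [(hc.sub hM).posSemidef_iff_eigenvalues_nonneg]
    intro i
    set μ := (hc.sub hM).eigenvalues i with hμ
    have hmem : μ ∈ eigs (c • (1 : Matrix ι ι ℝ) - M) := by
      have h := (hc.sub hM).eigenvalues_mem_spectrum_real i
      rw [← Matrix.spectrum_toLin'] at h
      exact Module.End.hasEigenvalue_iff_mem_spectrum.mpr h
    obtain ⟨y, hy, hyμ⟩ := mem_eigs_iff_exists.mp hmem
    have : c - μ ∈ eigs M := by
      refine mem_eigs_iff_exists.mpr ⟨y, hy, ?_⟩
      rw [Matrix.sub_mulVec, Matrix.smul_mulVec, Matrix.one_mulVec] at hyμ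
      rw [sub_smul, ← hyμ, sub_sub_cancel]
    have := h _ this
    simp only [Pi.zero_apply]
    linarith
  have := hpos.dotProduct_mulVec_nonneg x
  rw [Matrix.sub_mulVec, Matrix.smul_mulVec, Matrix.one_mulVec, dotProduct_sub,
    dotProduct_smul] at this
  simpa using this

theorem dotProduct_mulVec_le_of_lambdaMax_le {M : Matrix ι ι ℝ} (hM : M.IsHermitian) {c : ℝ}
    (h : lambdaMax M ≤ c) (x : ι → ℝ) : x ⬝ᵥ M.mulVec x ≤ c * (x ⬝ᵥ x) :=
  dotProduct_mulVec_le_of_eigs_le hM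
    (fun _ hμ => (le_csSup (eigs_finite M).bddAbove hμ).trans h) x

theorem dotProduct_neg_mulVec_le_of_le_lambdaMin {M : Matrix ι ι ℝ} (hM : M.IsHermitian) {c : ℝ}
    (h : -c ≤ lambdaMin M) (x : ι → ℝ) : x ⬝ᵥ (-M).mulVec x ≤ c * (x ⬝ᵥ x) := by
  refine dotProduct_mulVec_le_of_eigs_le hM.neg (fun μ hμ => ?_) x
  have : -μ ∈ eigs M := by
    obtain ⟨y, hy, hyμ⟩ := mem_eigs_iff_exists.mp hμ
    refine mem_eigs_iff_exists.mpr ⟨y, hy, ?_⟩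
    rw [neg_smul, ← hyμ, Matrix.neg_mulVec, neg_neg]
  have := csInf_le (eigs_finite M).bddBelow this
  unfold lambdaMin at h
  linarith

theorem lambdaMax_le [Nonempty ι] {M : Matrix ι ι ℝ} (hM : M.IsHermitian) {c : ℝ}
    (h : ∀ x, x ⬝ᵥ M.mulVec x ≤ c * (x ⬝ᵥ x)) : lambdaMax M ≤ c :=
  le_of_mem_eigs h (isGreatest_lambdaMax hM).1

theorem le_lambdaMin [Nonempty ι] {M : Matrix ι ι ℝ} (hM : M.IsHermitian) {c : ℝ}
    (h : ∀ x, x ⬝ᵥ (-M).mulVec x ≤ c * (x ⬝ᵥ x)) : -c ≤ lambdaMin M := by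
  have : -lambdaMin M ∈ eigs (-M) := by
    obtain ⟨y, hy, hyμ⟩ := mem_eigs_iff_exists.mp (isLeast_lambdaMin hM).1
    refine mem_eigs_iff_exists.mpr ⟨y, hy, ?_⟩
    rw [neg_smul, ← hyμ, Matrix.neg_mulVec]
  linarith [le_of_mem_eigs h this]

end RayleighQuotient

/-! ### The quadratic form of a token graph as a sum over pairs of vertices. -/

section TokenForm

variable {V : Type*} [DecidableEq V]

/-- The set obtained from `A` by moving a token from `a` to `b`. -/
def moveToken (A : Finset V) (a b : V) : Finset V := insert b (A.erase a)

theorem mem_moveToken {A : Finset V} {a b x : V} :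
    x ∈ moveToken A a b ↔ x = b ∨ x ≠ a ∧ x ∈ A := by
  simp [moveToken]

theorem card_moveToken {A : Finset V} {a b : V} (ha : a ∈ A) (hb : b ∉ A) :
    (moveToken A a b).card = A.card := by
  rw [moveToken, Finset.card_insert_of_notMem (by simp [hb]), Finset.card_erase_add_one ha]

theorem moveToken_moveToken {A : Finset V} {a b : V} (ha : a ∈ A) (hb : b ∉ A) :
    moveToken (moveToken A a b) b a = A := by
  ext x
  simp only [mem_moveToken]
  by_cases h1 : x = a <;> by_cases h2 : x = b <;> simp_all

theorem symmDiff_moveToken {A : Finset V} {a b : V} (ha : a ∈ A) (hb : b ∉ A) :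
    A ∆ moveToken A a b = {a, b} := by
  ext x
  simp only [Finset.mem_symmDiff, mem_moveToken, Finset.mem_insert, Finset.mem_singleton]
  by_cases h1 : x = a <;> by_cases h2 : x = b <;> simp_all

theorem eq_moveToken_of_symmDiff_eq {A B : Finset V} {a b : V} (ha : a ∈ A) (hb : b ∈ B)
    (h : A ∆ B = {a, b}) : a ∉ B ∧ b ∉ A ∧ B = moveToken A a b := by
  have key : ∀ x, (x ∈ A ∧ x ∉ B ∨ x ∈ B ∧ x ∉ A) ↔ (x = a ∨ x = b) := by
    intro x
    rw [← Finset.mem_symmDiff, h]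
    simp
  have h1 := key a
  have h2 := key b
  refine ⟨by grind, by grind, ?_⟩
  ext x
  have h3 := key x
  rw [mem_moveToken]
  grind

variable [Fintype V]

theorem sum_moveToken {M : Type*} [AddCommMonoid M] (a b : V) (F : Finset V → Finset V → M) :
    ∑ A with a ∈ A ∧ b ∉ A, F A (moveToken A a b) =
      ∑ B with b ∈ B ∧ a ∉ B, F (moveToken B b a) B := by
  have hmem : ∀ a b : V, ∀ A ∈ Finset.univ.filter (fun A : Finset V => a ∈ A ∧ b ∉ A),
      moveToken A a b ∈ Finset.univ.filter (fun A : Finset V => b ∈ A ∧ a ∉ A) := by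
    intro a b A hA
    simp only [Finset.mem_filter, Finset.mem_univ, true_and] at hA ⊢
    have : a ≠ b := fun h => hA.2 (h ▸ hA.1)
    simp [mem_moveToken, this]
  have hinv : ∀ a b : V, ∀ A ∈ Finset.univ.filter (fun A : Finset V => a ∈ A ∧ b ∉ A),
      moveToken (moveToken A a b) b a = A := by
    intro a b A hA
    simp only [Finset.mem_filter, Finset.mem_univ, true_and] at hA
    exact moveToken_moveToken hA.1 hA.2
  refine Finset.sum_bij' (fun A _ => moveToken A a b) (fun B _ => moveToken B b a)
    (hmem a b) (hmem b a) (hinv a b) (hinv b a) ?_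
  intro A hA
  rw [hinv a b A hA]

namespace WeightedGraph

/-- Neighbours of `A` in the token graph correspond bijectively to the edges of `G` leaving `A`,
with equal weights. -/
theorem sum_token_adjacency_mul (G : WeightedGraph V) (k : ℕ) (A : {A : Finset V // A.card = k})
    (Φ : Finset V → ℝ) :
    ∑ B, (G.token k).adjacency A B * Φ B.1 =
      ∑ a, ∑ b, if a ∈ A.1 ∧ b ∉ A.1 then G.adjacency a b * Φ (moveToken A.1 a b) else 0 := by
  classical
  rw [← Finset.sum_product' Finset.univ Finset.univ fun a b =>
    if a ∈ A.1 ∧ b ∉ A.1 then G.adjacency a b * Φ (moveToken A.1 a b) else 0]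
  rw [← Finset.sum_filter, ← Finset.sum_filter_of_ne (p := fun x : V × V => G.graph.Adj x.1 x.2)
    (fun x _ h => G.adj_of_adjacency_ne_zero (left_ne_zero_of_mul h))]
  rw [← Finset.sum_filter_of_ne (p := fun B => (G.token k).graph.Adj A B)
    (fun x _ h => (G.token k).adj_of_adjacency_ne_zero (left_ne_zero_of_mul h))]
  symm
  have hmem : ∀ x : V × V, x ∈ Finset.filter (fun x : V × V => G.graph.Adj x.1 x.2)
      (Finset.filter (fun x : V × V => x.1 ∈ A.1 ∧ x.2 ∉ A.1) (Finset.univ ×ˢ Finset.univ)) ↔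
      (x.1 ∈ A.1 ∧ x.2 ∉ A.1) ∧ G.graph.Adj x.1 x.2 := by
    intro x
    simp
  refine Finset.sum_bij (fun x hx => ⟨moveToken A.1 x.1 x.2, by
    rw [card_moveToken ((hmem x).mp hx).1.1 ((hmem x).mp hx).1.2, A.2]⟩) ?_ ?_ ?_ ?_
  · intro x hx
    have hx' := (hmem x).mp hx
    simp only [Finset.mem_filter, Finset.mem_univ, true_and]
    exact ⟨x.1, hx'.1.1, x.2, by simp [mem_moveToken], symmDiff_moveToken hx'.1.1 hx'.1.2, hx'.2⟩
  · intro x hx y hy hxy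
    obtain ⟨⟨hx1, hx2⟩, -⟩ := (hmem x).mp hx
    obtain ⟨⟨hy1, hy2⟩, -⟩ := (hmem y).mp hy
    have h : moveToken A.1 x.1 x.2 = moveToken A.1 y.1 y.2 := congrArg Subtype.val hxy
    have h1 := Finset.ext_iff.mp h x.2
    have h2 := Finset.ext_iff.mp h y.1
    simp only [mem_moveToken] at h1 h2
    refine Prod.ext ?_ ?_ <;> grind
  · intro B hB
    simp only [Finset.mem_filter, Finset.mem_univ, true_and] at hB
    obtain ⟨a, ha, b, hb, h, hab⟩ := hB
    obtain ⟨-, hbA, hBe⟩ := eq_moveToken_of_symmDiff_eq ha hb h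
    exact ⟨(a, b), (hmem _).mpr ⟨⟨ha, hbA⟩, hab⟩, Subtype.ext hBe.symm⟩
  · intro x hx
    obtain ⟨⟨hx1, hx2⟩, hx3⟩ := (hmem x).mp hx
    have hb : x.2 ∈ moveToken A.1 x.1 x.2 := by simp [mem_moveToken]
    have hs := symmDiff_moveToken hx1 hx2
    rw [G.adjacency_of_adj hx3, (G.token k).adjacency_of_adj ⟨x.1, hx1, x.2, hb, hs, hx3⟩]
    congr 1
    exact (G.tokenWeight_eq k A _ x.1 x.2 hx1 hb hs).symm

/-- The matrix `α D(G) + β A(G)`. -/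
def degreeAdjacency {V : Type*} [Fintype V] [DecidableEq V] (G : WeightedGraph V) (α β : ℝ) :
    Matrix V V ℝ := α • G.degreeMatrix + β • G.adjacency

theorem dotProduct_degreeAdjacency_mulVec (G : WeightedGraph V) (α β : ℝ) (x : V → ℝ) :
    x ⬝ᵥ (G.degreeAdjacency α β).mulVec x =
      ∑ u, ∑ v, G.adjacency u v * (α * x u ^ 2 + β * x u * x v) := by
  rw [dotProduct]
  refine Finset.sum_congr rfl fun u _ => ?_
  rw [degreeAdjacency, Matrix.add_mulVec, Matrix.smul_mulVec, Matrix.smul_mulVec, Pi.add_apply,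
    Pi.smul_apply, Pi.smul_apply, degreeMatrix, Matrix.mulVec_diagonal, Matrix.mulVec, dotProduct,
    Finset.sum_mul, smul_eq_mul, smul_eq_mul, Finset.mul_sum, Finset.mul_sum,
    ← Finset.sum_add_distrib, Finset.mul_sum]
  exact Finset.sum_congr rfl fun v _ => by ring

/-- The quadratic form of `α D + β A` on a token graph, as a sum over ordered pairs of vertices of
the original graph. -/
theorem dotProduct_token_degreeAdjacency_mulVec (G : WeightedGraph V) (k : ℕ) (α β : ℝ)
    (f : Finset V → ℝ) :
    (fun A : {A : Finset V // A.card = k} => f A.1) ⬝ᵥ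
        ((G.token k).degreeAdjacency α β).mulVec (fun A => f A.1) =
      ∑ a, ∑ b, G.adjacency a b * ∑ A with A.card = k ∧ a ∈ A ∧ b ∉ A,
        (α * f A ^ 2 + β * f A * f (moveToken A a b)) := by
  rw [dotProduct_degreeAdjacency_mulVec]
  have h1 : ∀ A : {A : Finset V // A.card = k},
      ∑ B, (G.token k).adjacency A B * (α * f A.1 ^ 2 + β * f A.1 * f B.1) =
      ∑ a, ∑ b, if a ∈ A.1 ∧ b ∉ A.1 then
        G.adjacency a b * (α * f A.1 ^ 2 + β * f A.1 * f (moveToken A.1 a b)) else 0 :=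
    fun A => G.sum_token_adjacency_mul k A fun B => α * f A.1 ^ 2 + β * f A.1 * f B
  rw [Finset.sum_congr rfl fun A _ => h1 A,
    ← Finset.sum_subtype (Finset.univ.filter fun A : Finset V => A.card = k) (by simp)
    (fun A => ∑ a, ∑ b, if a ∈ A ∧ b ∉ A then
        G.adjacency a b * (α * f A ^ 2 + β * f A * f (moveToken A a b)) else 0),
    Finset.sum_comm]
  refine Finset.sum_congr rfl fun a _ => ?_
  rw [Finset.sum_comm]
  refine Finset.sum_congr rfl fun b _ => ?_
  rw [← Finset.sum_filter, Finset.filter_filter, Finset.mul_sum]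

end WeightedGraph

end TokenForm

/-! ### The unconditional bound for stars. -/

section PairForm

variable {V : Type*} [Fintype V] [DecidableEq V]

/-- The contribution of the ordered pair `(a, b)` to the quadratic form of `α D + β A` on the token
graphs, evaluated at a function `f` on all sets of vertices. -/
def pairForm (α β : ℝ) (f : Finset V → ℝ) (a b : V) : ℝ :=
  ∑ A with a ∈ A ∧ b ∉ A, (α * f A ^ 2 + β * f A * f (moveToken A a b))

theorem pairForm_add_pairForm_swap (α β : ℝ) (f : Finset V → ℝ) (a b : V) :
    pairForm α β f a b + pairForm α β f b a = ∑ A with a ∈ A ∧ b ∉ A,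
      (α * (f A ^ 2 + f (moveToken A a b) ^ 2) + 2 * β * f A * f (moveToken A a b)) := by
  have h := sum_moveToken a b fun A B => α * f B ^ 2 + β * f B * f A
  rw [pairForm, pairForm, ← h, ← Finset.sum_add_distrib]
  exact Finset.sum_congr rfl fun A _ => by ring

theorem sq_abs_add_abs_le {p q : ℝ} (hp : 0 < p) (hq : 0 < q) (s t : ℝ) :
    (|s| + |t|) ^ 2 ≤ (p + q) * (s ^ 2 / p + t ^ 2 / q) := by
  have h : (p + q) * (s ^ 2 / p + t ^ 2 / q) - (|s| + |t|) ^ 2 =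
      (q * |s| - p * |t|) ^ 2 / (p * q) := by
    rw [← sq_abs s, ← sq_abs t]
    field_simp
    ring
  have : 0 ≤ (q * |s| - p * |t|) ^ 2 / (p * q) := by positivity
  linarith

/-- Only an inequality, because division by zero makes the left side `0` when `n = 0`; below this
happens for sets `A` that contain `S` or are disjoint from it. -/
theorem natCast_mul_div_le (n : ℕ) {x : ℝ} (hx : 0 ≤ x) : (n : ℝ) * (x / n) ≤ x := by
  rcases Nat.eq_zero_or_pos n with rfl | hn
  · simpa using hx
  · rw [mul_div_cancel₀]
    positivity

/-- The bound `d + 1` for the token graphs of a star with `d` edges, on a function `f` on all sets of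
vertices. -/
theorem sum_star_pairForm_le {α β : ℝ}
    (hαβ : ∀ s t : ℝ, α * (s ^ 2 + t ^ 2) + 2 * β * s * t ≤ (|s| + |t|) ^ 2)
    (f : Finset V → ℝ) (u : V) (S : Finset V) (hu : u ∉ S) :
    ∑ b ∈ S, (pairForm α β f u b + pairForm α β f b u) ≤ (S.card + 1) * ∑ A, f A ^ 2 := by
  -- A set containing `u` occurs once for each `b ∈ S \ A`, and its square is shared equally among
  -- these occurrences.
  have hout : ∑ b ∈ S, ∑ A with u ∈ A ∧ b ∉ A, f A ^ 2 / ((S \ A).card : ℝ) ≤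
      ∑ A with u ∈ A, f A ^ 2 := by
    have : ∑ b ∈ S, ∑ A with u ∈ A ∧ b ∉ A, f A ^ 2 / ((S \ A).card : ℝ) =
        ∑ A with u ∈ A, ∑ b ∈ S \ A, f A ^ 2 / ((S \ A).card : ℝ) := by
      refine Finset.sum_comm' fun b A => ?_
      simp only [Finset.mem_filter, Finset.mem_univ, true_and, Finset.mem_sdiff]
      tauto
    rw [this]
    refine Finset.sum_le_sum fun A _ => ?_
    rw [Finset.sum_const, nsmul_eq_mul]
    exact natCast_mul_div_le _ (sq_nonneg _)
  -- The target `B = moveToken A u b` satisfies `|S ∩ B| = |S ∩ A| + 1` and is reached once for each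
  -- `b ∈ S ∩ B`.
  have hin : ∑ b ∈ S, ∑ A with u ∈ A ∧ b ∉ A,
      f (moveToken A u b) ^ 2 / ((S ∩ A).card + 1 : ℝ) ≤ ∑ A with u ∉ A, f A ^ 2 := by
    have h1 : ∀ b ∈ S, ∑ A with u ∈ A ∧ b ∉ A,
        f (moveToken A u b) ^ 2 / ((S ∩ A).card + 1 : ℝ) =
        ∑ B with b ∈ B ∧ u ∉ B, f B ^ 2 / ((S ∩ B).card : ℝ) := by
      intro b hb
      rw [← sum_moveToken u b fun A B => f B ^ 2 / ((S ∩ B).card : ℝ)]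
      refine Finset.sum_congr rfl fun A hA => ?_
      simp only [Finset.mem_filter, Finset.mem_univ, true_and] at hA
      have : S ∩ moveToken A u b = insert b (S ∩ A) := by
        ext x
        simp only [Finset.mem_inter, mem_moveToken, Finset.mem_insert]
        grind
      rw [this, Finset.card_insert_of_notMem (by simp [hA.2])]
      push_cast
      rfl
    have h2 : ∑ b ∈ S, ∑ B with b ∈ B ∧ u ∉ B, f B ^ 2 / ((S ∩ B).card : ℝ) =
        ∑ B with u ∉ B, ∑ b ∈ S ∩ B, f B ^ 2 / ((S ∩ B).card : ℝ) := by
      refine Finset.sum_comm' fun b A => ?_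
      simp only [Finset.mem_filter, Finset.mem_univ, true_and, Finset.mem_inter]
      tauto
    rw [Finset.sum_congr rfl h1, h2]
    refine Finset.sum_le_sum fun A _ => ?_
    rw [Finset.sum_const, nsmul_eq_mul]
    exact natCast_mul_div_le _ (sq_nonneg _)
  have hterm : ∀ b ∈ S, pairForm α β f u b + pairForm α β f b u ≤
      (S.card + 1) * ∑ A with u ∈ A ∧ b ∉ A, (f A ^ 2 / ((S \ A).card : ℝ) +
        f (moveToken A u b) ^ 2 / ((S ∩ A).card + 1 : ℝ)) := by
    intro b hb
    rw [pairForm_add_pairForm_swap, Finset.mul_sum]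
    refine Finset.sum_le_sum fun A hA => (hαβ _ _).trans ?_
    simp only [Finset.mem_filter, Finset.mem_univ, true_and] at hA
    have hpos : (0 : ℝ) < (S \ A).card := by
      exact_mod_cast Finset.card_pos.mpr ⟨b, by simp [hb, hA.2]⟩
    -- The two multiplicities of a move always add up to `|S| + 1`; this is the constant that
    -- Cauchy-Schwarz produces.
    have hcard : (S.card : ℝ) + 1 = (S \ A).card + ((S ∩ A).card + 1) := by
      rw [← Finset.card_sdiff_add_card_inter S A]
      push_cast
      ring
    rw [hcard]
    exact sq_abs_add_abs_le hpos (by positivity) _ _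
  refine (Finset.sum_le_sum hterm).trans ?_
  rw [← Finset.mul_sum]
  refine mul_le_mul_of_nonneg_left ?_ (by positivity)
  simp only [Finset.sum_add_distrib]
  rw [← Finset.sum_filter_add_sum_filter_not Finset.univ (fun A : Finset V => u ∈ A)]
  exact add_le_add hout hin

end PairForm

/-! ### What the unweighted conjectures say about all levels together. -/

section ConjectureConsequences

open Classical in
/-- The statement that all eigenvalues of `α D + β A` on the `k`-th token graph of an unweighted
graph with `m` edges are at most `m + k`. -/
def UnweightedTokenBound (α β : ℝ) : Prop :=
  ∀ (n : ℕ) (G : SimpleGraph (Fin n)) (k : ℕ), 1 ≤ k → k ≤ n / 2 → ∀ x,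
    x ⬝ᵥ (((WeightedGraph.unweighted G).token k).degreeAdjacency α β).mulVec x ≤
      ((G.edgeFinset.card : ℝ) + k) * (x ⬝ᵥ x)

open Classical in
theorem two_mul_card_edgeFinset_eq_sum {V : Type*} [Fintype V] (H : SimpleGraph V) :
    2 * (H.edgeFinset.card : ℝ) = ∑ a, ∑ b, if H.Adj a b then 1 else 0 := by
  have h : 2 * H.edgeFinset.card = _ := H.two_mul_card_edgeFinset
  rw [Finset.card_filter, ← Finset.univ_product_univ, Finset.sum_product] at h
  exact_mod_cast h

open Classical in
theorem sum_unweighted_adjacency_mul {V : Type*} [Fintype V] (H : SimpleGraph V) (F : V → V → ℝ) :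
    ∑ a, ∑ b, (WeightedGraph.unweighted H).adjacency a b * F a b =
      ∑ a, ∑ b, if H.Adj a b then F a b else 0 := by
  refine Finset.sum_congr rfl fun a _ => Finset.sum_congr rfl fun b _ => ?_
  by_cases h : H.Adj a b <;> simp [WeightedGraph.adjacency, WeightedGraph.unweighted, h]

variable {α β : ℝ}

theorem sum_card_eq_sq {V : Type*} [Fintype V] [DecidableEq V] (f : Finset V → ℝ) (k : ℕ) :
    (fun A : {A : Finset V // A.card = k} => f A.1) ⬝ᵥ (fun A => f A.1) =
      ∑ A with A.card = k, f A ^ 2 := by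
  rw [Finset.sum_subtype (Finset.univ.filter fun A : Finset V => A.card = k) (p := fun A => A.card = k) (by simp)
    fun A => f A ^ 2, dotProduct]
  exact Finset.sum_congr rfl fun A _ => by ring

open Classical in
theorem UnweightedTokenBound.level_le_of_le_half (h : UnweightedTokenBound α β) {n : ℕ}
    (G : SimpleGraph (Fin n)) (k : ℕ) (hk : k ≤ n / 2) (f : Finset (Fin n) → ℝ) :
    ∑ a, ∑ b, (if G.Adj a b then ∑ A with A.card = k ∧ a ∈ A ∧ b ∉ A,
        (α * f A ^ 2 + β * f A * f (moveToken A a b)) else 0) ≤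
      ((G.edgeFinset.card : ℝ) + k) * ∑ A with A.card = k, f A ^ 2 := by
  -- Level `0` lies outside the conjectures but occurs later, when a set has no token in `S`; no
  -- move is possible there.
  rcases Nat.eq_zero_or_pos k with rfl | hpos
  · have h0 : ∀ a b : Fin n,
        (Finset.univ.filter fun A : Finset (Fin n) => A.card = 0 ∧ a ∈ A ∧ b ∉ A) = ∅ := by
      intro a b
      refine Finset.filter_false_of_mem fun A _ hA => ?_
      rw [Finset.card_eq_zero] at hA
      simp [hA.1] at hA
    simp only [h0, Finset.sum_empty, ite_self, Finset.sum_const_zero]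
    positivity
  · have := h n G k hpos hk fun A => f A.1
    rw [WeightedGraph.dotProduct_token_degreeAdjacency_mulVec, sum_card_eq_sq,
      sum_unweighted_adjacency_mul] at this
    exact this

open Classical in
-- Complementation identifies levels `k` and `n - k` and reverses moves. The constant is weakened to
-- `n / 2` to be the same at every level.
theorem UnweightedTokenBound.level_le (h : UnweightedTokenBound α β) {n : ℕ}
    (G : SimpleGraph (Fin n)) (k : ℕ) (hk : k ≤ n) (f : Finset (Fin n) → ℝ) :
    ∑ a, ∑ b, (if G.Adj a b then ∑ A with A.card = k ∧ a ∈ A ∧ b ∉ A,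
        (α * f A ^ 2 + β * f A * f (moveToken A a b)) else 0) ≤
      ((G.edgeFinset.card : ℝ) + (n / 2 : ℕ)) * ∑ A with A.card = k, f A ^ 2 := by
  rcases le_or_gt k (n / 2) with hk2 | hk2
  · refine (h.level_le_of_le_half G k hk2 f).trans (mul_le_mul_of_nonneg_right ?_ ?_)
    · gcongr
    · positivity
  · have hc := h.level_le_of_le_half G (n - k) (by omega) fun A => f Aᶜ
    have hcard : ∀ A : Finset (Fin n), Aᶜ.card = n - k ↔ A.card = k := by
      intro A
      have := Finset.card_le_univ A
      rw [Finset.card_compl]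
      simp only [Fintype.card_fin] at *
      omega
    have hmove : ∀ (A : Finset (Fin n)) (a b : Fin n), a ∈ A → b ∉ A →
        (moveToken Aᶜ b a)ᶜ = moveToken A a b := by
      intro A a b ha hb
      ext x
      simp only [Finset.mem_compl, mem_moveToken]
      grind
    have h1 : ∀ a b : Fin n, ∑ A with A.card = n - k ∧ b ∈ A ∧ a ∉ A,
        (α * f Aᶜ ^ 2 + β * f Aᶜ * f (moveToken A b a)ᶜ) =
        ∑ A with A.card = k ∧ a ∈ A ∧ b ∉ A,
          (α * f A ^ 2 + β * f A * f (moveToken A a b)) := by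
      intro a b
      symm
      refine Finset.sum_bij' (fun A _ => Aᶜ) (fun A _ => Aᶜ) ?_ ?_ ?_ ?_ ?_
      · intro A hA
        simp only [Finset.mem_filter, Finset.mem_univ, true_and] at hA ⊢
        rw [hcard]
        simpa [and_comm] using hA
      · intro A hA
        simp only [Finset.mem_filter, Finset.mem_univ, true_and] at hA ⊢
        rw [← hcard, compl_compl]
        simpa [and_comm] using hA
      · intro A _
        exact compl_compl A
      · intro A _
        exact compl_compl A
      · intro A hA
        simp only [Finset.mem_filter, Finset.mem_univ, true_and] at hA
        rw [compl_compl, hmove A a b hA.2.1 hA.2.2]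
    have h2 : ∑ A with A.card = n - k, f Aᶜ ^ 2 = ∑ A with A.card = k, f A ^ 2 := by
      symm
      refine Finset.sum_bij' (fun A _ => Aᶜ) (fun A _ => Aᶜ) ?_ ?_ ?_ ?_ ?_
      · intro A hA
        simp only [Finset.mem_filter, Finset.mem_univ, true_and] at hA ⊢
        rwa [hcard]
      · intro A hA
        simp only [Finset.mem_filter, Finset.mem_univ, true_and] at hA ⊢
        rwa [← hcard, compl_compl]
      · intro A _
        exact compl_compl A
      · intro A _
        exact compl_compl A
      · intro A _
        rw [compl_compl]
    rw [h2, Finset.sum_comm] at hc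
    simp only [h1] at hc
    simp only [G.adj_comm] at hc ⊢
    refine hc.trans (mul_le_mul_of_nonneg_right ?_ ?_)
    · have : n - k ≤ n / 2 := by omega
      gcongr
    · positivity

open Classical in
-- Moves preserve the number of tokens, so the form is the sum of its restrictions to the levels.
theorem UnweightedTokenBound.sum_pairForm_le (h : UnweightedTokenBound α β) {n : ℕ}
    (G : SimpleGraph (Fin n)) (f : Finset (Fin n) → ℝ) :
    ∑ a, ∑ b, (if G.Adj a b then pairForm α β f a b else 0) ≤
      ((G.edgeFinset.card : ℝ) + (n / 2 : ℕ)) * ∑ A, f A ^ 2 := by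
  have hmaps : ∀ A : Finset (Fin n), A.card ∈ Finset.range (n + 1) := by
    intro A
    have := Finset.card_le_univ A
    simp only [Fintype.card_fin] at this
    simpa [Nat.lt_succ_iff] using this
  have h1 : ∑ A, f A ^ 2 = ∑ k ∈ Finset.range (n + 1), ∑ A with A.card = k, f A ^ 2 :=
    (Finset.sum_fiberwise_of_maps_to (fun A _ => hmaps A) _).symm
  have h2 : ∀ a b, pairForm α β f a b = ∑ k ∈ Finset.range (n + 1),
      ∑ A with A.card = k ∧ a ∈ A ∧ b ∉ A,
        (α * f A ^ 2 + β * f A * f (moveToken A a b)) := by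
    intro a b
    rw [pairForm, ← Finset.sum_fiberwise_of_maps_to (g := Finset.card) (fun A _ => hmaps A)]
    refine Finset.sum_congr rfl fun k _ => ?_
    rw [Finset.filter_filter]
    simp only [and_comm]
  have h3 : ∑ a, ∑ b, (if G.Adj a b then pairForm α β f a b else 0) =
      ∑ k ∈ Finset.range (n + 1), ∑ a, ∑ b,
        (if G.Adj a b then ∑ A with A.card = k ∧ a ∈ A ∧ b ∉ A,
          (α * f A ^ 2 + β * f A * f (moveToken A a b)) else 0) := by
    symm
    rw [Finset.sum_comm]
    refine Finset.sum_congr rfl fun a _ => ?_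
    rw [Finset.sum_comm]
    refine Finset.sum_congr rfl fun b _ => ?_
    rw [h2]
    split_ifs <;> simp
  rw [h3, h1, Finset.mul_sum]
  exact Finset.sum_le_sum fun k hk =>
    h.level_le G k (by simpa [Nat.lt_succ_iff] using hk) f

end ConjectureConsequences

/-! ### Graphs supported on a vertex set `S`. -/

section InducedSubgraph

open Classical in
theorem sum_adj_eq_sum_comap {V : Type*} [Fintype V] {s : ℕ} (ι : Fin s ↪ V) (S : Finset V)
    (hS : Finset.univ.map ι = S) (H : SimpleGraph V) (hH : ∀ a b, H.Adj a b → a ∈ S)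
    (F : V → V → ℝ) :
    ∑ a, ∑ b, (if H.Adj a b then F a b else 0) =
      ∑ i, ∑ j, if (H.comap ι).Adj i j then F (ι i) (ι j) else 0 := by
  have h1 : ∀ φ : V → ℝ, (∀ v, v ∉ S → φ v = 0) → ∑ v, φ v = ∑ i, φ (ι i) := by
    intro φ hφ
    rw [← Finset.sum_map Finset.univ ι φ, hS]
    exact (Finset.sum_subset (Finset.subset_univ S) fun v _ hv => hφ v hv).symm
  rw [h1 _ fun a ha => Finset.sum_eq_zero fun b _ => if_neg fun h => ha (hH a b h)]
  refine Finset.sum_congr rfl fun i _ => ?_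
  rw [h1 _ fun b hb => if_neg fun h => hb (hH b _ h.symm)]
  rfl

variable {V : Type*} [Fintype V] [DecidableEq V]

/-- A set of vertices is determined by its trace on the range of `ι` and its part off that range. -/
theorem sum_finset_eq_sum_trace {M : Type*} [AddCommMonoid M] {s : ℕ} (ι : Fin s ↪ V)
    (S : Finset V) (hS : Finset.univ.map ι = S) (F : Finset V → M) :
    ∑ A, F A = ∑ B ∈ Sᶜ.powerset, ∑ T : Finset (Fin s), F (T.map ι ∪ B) := by
  have hι : ∀ i, ι i ∈ S := fun i => by simp [← hS]
  have hι' : ∀ v ∈ S, ∃ i, ι i = v := fun v hv => by simpa [← hS] using hv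
  refine Eq.trans ?_ (Finset.sum_product' Sᶜ.powerset Finset.univ
    fun (B : Finset V) (T : Finset (Fin s)) => F (T.map ι ∪ B))
  have hB : ∀ x ∈ Sᶜ.powerset ×ˢ (Finset.univ : Finset (Finset (Fin s))), ∀ v ∈ x.1, v ∉ S := by
    intro x hx v hv
    simp only [Finset.mem_product, Finset.mem_powerset] at hx
    simpa using hx.1 hv
  refine Finset.sum_bij' (fun A _ => (A \ S, Finset.univ.filter fun i => ι i ∈ A))
    (fun x _ => x.2.map ι ∪ x.1) ?_ ?_ ?_ ?_ ?_
  · intro A _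
    simp only [Finset.mem_product, Finset.mem_powerset, Finset.mem_univ, and_true]
    intro v hv
    simp only [Finset.mem_sdiff] at hv
    simpa using hv.2
  · intro x _
    exact Finset.mem_univ _
  · intro A _
    ext v
    simp only [Finset.mem_union, Finset.mem_map, Finset.mem_filter, Finset.mem_univ, true_and,
      Finset.mem_sdiff]
    constructor
    · rintro (⟨i, hi, rfl⟩ | h)
      · exact hi
      · exact h.1
    · intro hv
      by_cases hvS : v ∈ S
      · obtain ⟨i, rfl⟩ := hι' v hvS
        exact Or.inl ⟨i, hv, rfl⟩
      · exact Or.inr ⟨hv, hvS⟩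
  · intro x hx
    have hx' := hB x hx
    refine Prod.ext ?_ ?_
    · ext v
      simp only [Finset.mem_union, Finset.mem_map, Finset.mem_sdiff]
      constructor
      · rintro ⟨⟨i, -, rfl⟩ | h, hv⟩
        · exact absurd (hι i) hv
        · exact h
      · exact fun h => ⟨Or.inr h, hx' v h⟩
    · ext i
      simp only [Finset.mem_filter, Finset.mem_univ, true_and, Finset.mem_union, Finset.mem_map,
        EmbeddingLike.apply_eq_iff_eq, exists_eq_right, or_iff_left_iff_imp]
      exact fun h => absurd (hι i) (hx' _ h)
  · intro A _
    congr 1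
    ext v
    simp only [Finset.mem_union, Finset.mem_map, Finset.mem_filter, Finset.mem_univ, true_and,
      Finset.mem_sdiff]
    constructor
    · intro hv
      by_cases hvS : v ∈ S
      · obtain ⟨i, rfl⟩ := hι' v hvS
        exact Or.inl ⟨i, hv, rfl⟩
      · exact Or.inr ⟨hv, hvS⟩
    · rintro (⟨i, hi, rfl⟩ | h)
      · exact hi
      · exact h.1

/-- A move between two vertices of `S` leaves the part `B` of the set outside `S` unchanged. -/
theorem pairForm_eq_sum_trace (α β : ℝ) {s : ℕ} (ι : Fin s ↪ V) (S : Finset V)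
    (hS : Finset.univ.map ι = S) (f : Finset V → ℝ) (i j : Fin s) :
    pairForm α β f (ι i) (ι j) =
      ∑ B ∈ Sᶜ.powerset, pairForm α β (fun T => f (T.map ι ∪ B)) i j := by
  have hι : ∀ i, ι i ∈ S := fun i => by simp [← hS]
  unfold pairForm
  rw [Finset.sum_filter, sum_finset_eq_sum_trace ι S hS]
  refine Finset.sum_congr rfl fun B hB => ?_
  have hB' : ∀ i, ι i ∉ B := fun i hi => by
    have := Finset.mem_powerset.mp hB hi
    simp [hι i] at this
  rw [Finset.sum_filter]
  refine Finset.sum_congr rfl fun T _ => ?_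
  have hmem : ∀ i, ι i ∈ T.map ι ∪ B ↔ i ∈ T := fun i => by simp [hB' i]
  have hmove : moveToken (T.map ι ∪ B) (ι i) (ι j) = (moveToken T i j).map ι ∪ B := by
    ext v
    simp only [mem_moveToken, Finset.mem_union, Finset.mem_map]
    constructor
    · rintro (rfl | ⟨hv, ⟨l, hl, rfl⟩ | h⟩)
      · exact Or.inl ⟨j, Or.inl rfl, rfl⟩
      · exact Or.inl ⟨l, Or.inr ⟨fun h => hv (h ▸ rfl), hl⟩, rfl⟩
      · exact Or.inr h
    · rintro (⟨l, rfl | ⟨hl, hl'⟩, rfl⟩ | h)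
      · exact Or.inl rfl
      · exact Or.inr ⟨fun h => hl (ι.injective h), Or.inl ⟨l, hl', rfl⟩⟩
      · exact Or.inr ⟨fun h' => hB' i (h' ▸ h), Or.inr h⟩
  simp only [hmem, hmove]

variable {α β : ℝ}

open Classical in
-- For each frozen part `B` outside `S` the form is one on `|S|` vertices, and summing over `B`
-- keeps the constant. The vertices of `S` are relabelled by `Fin S.card` because the conjectures
-- are stated there.
theorem UnweightedTokenBound.sum_pairForm_le_of_subset (h : UnweightedTokenBound α β)
    (H : SimpleGraph V) (S : Finset V) (hH : ∀ a b, H.Adj a b → a ∈ S) (f : Finset V → ℝ) :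
    ∑ a, ∑ b, (if H.Adj a b then pairForm α β f a b else 0) ≤
      ((H.edgeFinset.card : ℝ) + (S.card / 2 : ℕ)) * ∑ A, f A ^ 2 := by
  set ι : Fin S.card ↪ V := S.equivFin.symm.toEmbedding.trans (Function.Embedding.subtype _) with hι
  have hS : Finset.univ.map ι = S := by
    rw [hι, ← Finset.map_map, Finset.map_univ_equiv]
    ext v
    simp
  have hedge : ((H.comap ι).edgeFinset.card : ℝ) = H.edgeFinset.card := by
    have h1 := two_mul_card_edgeFinset_eq_sum H
    have h2 := two_mul_card_edgeFinset_eq_sum (H.comap ι)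
    rw [sum_adj_eq_sum_comap ι S hS H hH fun _ _ => 1] at h1
    refine mul_left_cancel₀ two_ne_zero (h2.trans (Eq.trans ?_ h1.symm))
    congr!
  have hsum : ∑ i, ∑ j, (if (H.comap ι).Adj i j then pairForm α β f (ι i) (ι j) else 0) =
      ∑ B ∈ Sᶜ.powerset, ∑ i, ∑ j, if (H.comap ι).Adj i j then
        pairForm α β (fun T => f (T.map ι ∪ B)) i j else 0 := by
    symm
    rw [Finset.sum_comm]
    refine Finset.sum_congr rfl fun i _ => ?_
    rw [Finset.sum_comm]
    refine Finset.sum_congr rfl fun j _ => ?_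
    rw [pairForm_eq_sum_trace α β ι S hS]
    split_ifs <;> simp
  rw [sum_adj_eq_sum_comap ι S hS H hH, hsum, sum_finset_eq_sum_trace ι S hS, Finset.mul_sum,
    ← hedge]
  exact Finset.sum_le_sum fun B _ => h.sum_pairForm_le (H.comap ι) fun T => f (T.map ι ∪ B)

end InducedSubgraph

/-! ### From unweighted to weighted bounds. -/

section Main

variable {α β : ℝ}

/-- A bound `m + k` for all unweighted token graphs implies the bound `W + M_k` for all weighted
ones. -/
theorem UnweightedTokenBound.dotProduct_le (h : UnweightedTokenBound α β)
    (hαβ : ∀ s t : ℝ, α * (s ^ 2 + t ^ 2) + 2 * β * s * t ≤ (|s| + |t|) ^ 2)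
    {n : ℕ} (G : WeightedGraph (Fin n)) {k : ℕ} (hkn : k ≤ n / 2)
    (x : {A : Finset (Fin n) // A.card = k} → ℝ) :
    x ⬝ᵥ ((G.token k).degreeAdjacency α β).mulVec x ≤
      (G.totalWeight + G.maxMatchingWeight k) * (x ⬝ᵥ x) := by
  classical
  by_cases hx : x = 0
  · simp [hx]
  set f : Finset (Fin n) → ℝ := fun A => if hA : A.card = k then x ⟨A, hA⟩ else 0 with hf
  have hfx : x = fun A => f A.1 := by
    funext A
    simp [hf, A.2]
  have hf0 : ∀ A, f A ≠ 0 → A.card = k := by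
    intro A hA
    by_contra hcard
    simp [hf, hcard] at hA
  have hlevel : ∀ a b, ∑ A with A.card = k ∧ a ∈ A ∧ b ∉ A,
      (α * f A ^ 2 + β * f A * f (moveToken A a b)) = pairForm α β f a b := by
    intro a b
    rw [pairForm, ← Finset.sum_filter_of_ne (s := Finset.univ.filter fun A => a ∈ A ∧ b ∉ A)
      (p := fun A : Finset (Fin n) => A.card = k)]
    · rw [Finset.filter_filter]
      simp only [and_comm]
    · intro A _ hA
      refine hf0 A fun h0 => hA ?_
      simp [h0]
  have hnorm : x ⬝ᵥ x = ∑ A, f A ^ 2 := by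
    rw [hfx, sum_card_eq_sq]
    exact Finset.sum_filter_of_ne fun A _ hA => hf0 A fun h0 => hA (by simp [h0])
  have hpos : 0 < ∑ A, f A ^ 2 := hnorm ▸ dotProduct_self_pos_of_ne_zero hx
  set N := ∑ A, f A ^ 2 with hN
  have hform : x ⬝ᵥ ((G.token k).degreeAdjacency α β).mulVec x =
      ∑ a, ∑ b, G.adjacency a b * pairForm α β f a b := by
    rw [hfx, WeightedGraph.dotProduct_token_degreeAdjacency_mulVec]
    simp only [hlevel]
  -- Subtracting `1` for each ordered pair removes exactly `2 m`, so a bound `m + r` for the form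
  -- becomes `2 r`.
  have hgraph : ∀ (H : SimpleGraph (Fin n)) (r : ℕ),
      ∑ a, ∑ b, (if H.Adj a b then pairForm α β f a b else 0) ≤
        ((H.edgeFinset.card : ℝ) + r) * N →
      ∑ a, ∑ b, (if H.Adj a b then 2 * pairForm α β f a b / N - 1 else 0) ≤
        ((2 * r : ℕ) : ℝ) := by
    intro H r hr
    have h1 : ∑ a, ∑ b, (if H.Adj a b then 2 * pairForm α β f a b / N - 1 else 0) =
        2 / N * (∑ a, ∑ b, (if H.Adj a b then pairForm α β f a b else 0)) -
          ∑ a, ∑ b, (if H.Adj a b then 1 else 0) := by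
      simp only [Finset.mul_sum, ← Finset.sum_sub_distrib]
      refine Finset.sum_congr rfl fun a _ => Finset.sum_congr rfl fun b _ => ?_
      split_ifs
      · ring
      · ring
    have h2 : 2 / N * (∑ a, ∑ b, (if H.Adj a b then pairForm α β f a b else 0)) ≤
        2 * ((H.edgeFinset.card : ℝ) + r) := by
      rw [div_mul_eq_mul_div, div_le_iff₀ hpos]
      linarith
    rw [h1, ← two_mul_card_edgeFinset_eq_sum H]
    push_cast
    linarith
  -- Here `g a b + g b a = 2 y_e`; the three side goals are the star, vertex set and cardinality
  -- inequalities.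
  have key := G.sum_adjacency_mul_le_maxMatchingWeight (k := k)
    (g := fun a b => 2 * pairForm α β f a b / N - 1) ?_ ?_ ?_
  · have h1 : ∑ a, ∑ b, G.adjacency a b * (2 * pairForm α β f a b / N - 1) =
        2 / N * (∑ a, ∑ b, G.adjacency a b * pairForm α β f a b) -
          ∑ a, ∑ b, G.adjacency a b := by
      simp only [Finset.mul_sum, ← Finset.sum_sub_distrib]
      exact Finset.sum_congr rfl fun a _ => Finset.sum_congr rfl fun b _ => by ring
    rw [h1, G.sum_adjacency_eq_two_mul_totalWeight, ← hform] at key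
    rw [hnorm, ← div_le_iff₀ hpos]
    have h2 : 2 / N * (x ⬝ᵥ ((G.token k).degreeAdjacency α β).mulVec x) =
        2 * (x ⬝ᵥ ((G.token k).degreeAdjacency α β).mulVec x / N) := by ring
    linarith
  · intro u S hu
    have hst := sum_star_pairForm_le hαβ f u S hu
    rw [← hN, ← div_le_iff₀ hpos] at hst
    have h1 : ∑ b ∈ S, (2 * pairForm α β f u b / N - 1 + (2 * pairForm α β f b u / N - 1)) =
        2 * ((∑ b ∈ S, (pairForm α β f u b + pairForm α β f b u)) / N) - 2 * S.card := by
      rw [Finset.sum_div, Finset.mul_sum, mul_comm, ← nsmul_eq_mul, ← Finset.sum_const,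
        ← Finset.sum_sub_distrib]
      exact Finset.sum_congr rfl fun b _ => by ring
    rw [h1]
    linarith
  · intro H S hH
    exact hgraph H _ (h.sum_pairForm_le_of_subset H S hH f)
  · intro H
    have h1 := h.level_le_of_le_half H k hkn f
    simp only [hlevel] at h1
    refine hgraph H k (h1.trans (le_of_eq ?_))
    rw [hN]
    congr 1
    exact Finset.sum_filter_of_ne fun A _ hA => hf0 A fun h0 => hA (by simp [h0])

theorem WeightedGraph.degreeAdjacency_one_neg_one {V : Type*} [Fintype V] [DecidableEq V]
    (G : WeightedGraph V) : G.degreeAdjacency 1 (-1) = G.laplacian := by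
  rw [degreeAdjacency, laplacian, one_smul, neg_one_smul, sub_eq_add_neg]

theorem WeightedGraph.degreeAdjacency_one_one {V : Type*} [Fintype V] [DecidableEq V]
    (G : WeightedGraph V) : G.degreeAdjacency 1 1 = G.signlessLaplacian := by
  rw [degreeAdjacency, signlessLaplacian, one_smul, one_smul]

theorem WeightedGraph.dotProduct_degreeAdjacency_zero_mulVec {V : Type*} [Fintype V]
    [DecidableEq V] (G : WeightedGraph V) (β : ℝ) (x : V → ℝ) :
    x ⬝ᵥ (G.degreeAdjacency 0 β).mulVec x = β * (x ⬝ᵥ G.adjacency.mulVec x) := by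
  rw [degreeAdjacency, zero_smul, zero_add, Matrix.smul_mulVec, dotProduct_smul, smul_eq_mul]

theorem ConjectureLMax.unweightedTokenBound (h : ConjectureLMax) :
    UnweightedTokenBound 1 (-1) := by
  intro n G k hk hkn x
  rw [WeightedGraph.degreeAdjacency_one_neg_one]
  exact dotProduct_mulVec_le_of_lambdaMax_le (WeightedGraph.laplacian_isHermitian _)
    (h n G k hk hkn) x

theorem ConjectureQMax.unweightedTokenBound (h : ConjectureQMax) :
    UnweightedTokenBound 1 1 := by
  intro n G k hk hkn x
  rw [WeightedGraph.degreeAdjacency_one_one]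
  exact dotProduct_mulVec_le_of_lambdaMax_le (WeightedGraph.signlessLaplacian_isHermitian _)
    (h n G k hk hkn) x

/-- The coefficient `2` turns `(m + k) / 2` into `m + k`. It still satisfies the star hypothesis,
because `4 s t ≤ (|s| + |t|)²`. -/
theorem ConjectureAMax.unweightedTokenBound (h : ConjectureAMax) :
    UnweightedTokenBound 0 2 := by
  intro n G k hk hkn x
  rw [WeightedGraph.dotProduct_degreeAdjacency_zero_mulVec]
  have := dotProduct_mulVec_le_of_lambdaMax_le (WeightedGraph.adjacency_isHermitian _)
    (h n G k hk hkn) x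
  linarith

theorem ConjectureAMin.unweightedTokenBound (h : ConjectureAMin) :
    UnweightedTokenBound 0 (-2) := by
  intro n G k hk hkn x
  rw [WeightedGraph.dotProduct_degreeAdjacency_zero_mulVec]
  have h' := h n G k hk hkn
  rw [ge_iff_le, neg_mul] at h'
  have := dotProduct_neg_mulVec_le_of_le_lambdaMin (WeightedGraph.adjacency_isHermitian _) h' x
  rw [Matrix.neg_mulVec, dotProduct_neg] at this
  linarith

theorem mul_le_abs_mul_abs (s t : ℝ) : s * t ≤ |s| * |t| ∧ -(s * t) ≤ |s| * |t| := by
  rw [← abs_mul]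
  exact ⟨le_abs_self _, neg_le_abs _⟩

end Main

end

theorem mainTheorem1 (n : ℕ) (G : WeightedGraph (Fin n)) (k : ℕ) (hk : 1 ≤ k) (hkn : k ≤ n / 2) :
    (ConjectureLMax →
      lambdaMax (G.token k).laplacian ≤ G.totalWeight + G.maxMatchingWeight k) ∧
    (ConjectureQMax →
      lambdaMax (G.token k).signlessLaplacian ≤ G.totalWeight + G.maxMatchingWeight k) ∧
    (ConjectureAMax →
      lambdaMax (G.token k).adjacency ≤ 1 / 2 * (G.totalWeight + G.maxMatchingWeight k)) ∧
    (ConjectureAMin →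
      lambdaMin (G.token k).adjacency ≥ -(1 / 2) * (G.totalWeight + G.maxMatchingWeight k)) := by
  -- Without a vertex of the token graph the set of eigenvalues would be empty and `sSup`, `sInf`
  -- would take default values; here both are attained.
  have : Nonempty {A : Finset (Fin n) // A.card = k} := by
    obtain ⟨A, -, hA⟩ := Finset.exists_subset_card_eq (s := (Finset.univ : Finset (Fin n)))
      (n := k) (by simp only [Finset.card_univ, Fintype.card_fin]; omega)
    exact ⟨⟨A, hA⟩⟩
  refine ⟨fun h => ?_, fun h => ?_, fun h => ?_, fun h => ?_⟩
  · refine lambdaMax_le (G.token k).laplacian_isHermitian fun x => ?_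
    rw [← WeightedGraph.degreeAdjacency_one_neg_one]
    refine h.unweightedTokenBound.dotProduct_le (fun s t => ?_) G hkn x
    have := (mul_le_abs_mul_abs s t).2
    rw [add_sq, sq_abs, sq_abs]
    linarith
  · refine lambdaMax_le (G.token k).signlessLaplacian_isHermitian fun x => ?_
    rw [← WeightedGraph.degreeAdjacency_one_one]
    refine h.unweightedTokenBound.dotProduct_le (fun s t => ?_) G hkn x
    have := (mul_le_abs_mul_abs s t).1
    rw [add_sq, sq_abs, sq_abs]
    linarith
  · refine lambdaMax_le (G.token k).adjacency_isHermitian fun x => ?_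
    have hb := h.unweightedTokenBound.dotProduct_le (fun s t => ?_) G hkn x
    · rw [WeightedGraph.dotProduct_degreeAdjacency_zero_mulVec] at hb
      linarith
    · have := (mul_le_abs_mul_abs s t).1
      have := sq_nonneg (|s| - |t|)
      nlinarith
  · rw [ge_iff_le, neg_mul]
    refine le_lambdaMin (G.token k).adjacency_isHermitian fun x => ?_
    have hb := h.unweightedTokenBound.dotProduct_le (fun s t => ?_) G hkn x
    · rw [WeightedGraph.dotProduct_degreeAdjacency_zero_mulVec] at hb
      rw [Matrix.neg_mulVec, dotProduct_neg]
      linarith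
    · have := (mul_le_abs_mul_abs s t).2
      have := sq_nonneg (|s| - |t|)
      nlinarith
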